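/- **Setting.** Let $d\ge 1$, $\mathcal B_1=\{\theta\in\mathbb R^d:\|\theta\|_1\le 1\}$, and let $(\mathcal F_t)_{t\ge 0}$ be a filtration on a probability space; write $\mathbb E_{t-1}=\mathbb E[\,\cdot\,|\mathcal F_{t-1}]$. Let $(\ell_t)_{t\ge1}$ be random convex functions $\mathbb R^d\to\mathbb R$ with (measurably chosen) subgradients $\nabla\ell_t$, both $\mathcal F_t$-measurable, with $\ell_t(\theta)$ integrable for $\theta\in\mathcal B_1$. Assume: (A1) for some $G$, almost surely $\|\nabla\ell_t(\theta)\|_\infty\le G$ for all $t\ge1$, $\theta\in\mathcal B_1$; (A2) for some $\alpha>0$, $\beta\in[0,1]$, for all $t\ge1$ and $\theta_1,\theta_2\in\mathcal B_1$, almost surely $$\mathbb E_{t-1}[\ell_t(\theta_1)-\ell_t(\theta_2)]\le \mathbb E_{t-1}[\nabla\ell_t(\theta_1)^\top(\theta_1-\theta_2)]-\mathbb E_{t-1}\Big[\big(\alpha(\nabla\ell_t(\theta_1)^\top(\theta_1-\theta_2))^2\big)^{1/\beta}\Big],$$ where for $\beta=0$ we read $u^{1/\beta}$ as $0$ if $u\le1$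 and $+\infty$ if $u>1$ (so that (A2) then requires $\alpha(\nabla\ell_t(\theta_1)^\top(\theta_1-\theta_2))^2\le1$ almost surely). **Algorithm.** Given a horizon $T\ge1$, a finite grid $\Theta_0=\{\theta_1,\dots,\theta_K\}\subset\mathcal B_1$, $E>0$ and prior weights $\hat\pi_{k,0}$, put $\eta_i=(e^iE)^{-1}$ for integers $1\le i\le\log(ET)$. In round $t=1,\dots,T$ predict $\hat\theta_{t-1}=\sum_k\hat\pi_{k,t-1}\theta_k$, observe $\nabla\ell_t(\hat\theta_{t-1})$, and set $$\hat\pi_{k,t}=\frac{\sum_i\eta_i\exp\big(\eta_i\sum_{s\le t}(r_{k,s}-\eta_ir_{k,s}^2)\big)\hat\pi_{k,0}}{\sum_{j}\sum_{i}\eta_i\exp\big(\eta_i\sum_{s\le t}(r_{j,s}-\eta_ir_{j,s}^2)\big)\hat\pi_{j,0}},\qquad r_{k,s}=\nabla\ell_s(\hat\theta_{s-1})^\top(\hat\theta_{s-1}-\theta_k).$$ For $\theta\in\mathcal B_1$ let $R_T(\theta)=\frac1T\sum_{t=1}^T\mathbb E_{t-1}[\ell_t(\hat\theta_{t-1})]-\frac1T\sum_{t=1}^T\mathbb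 E_{t-1}[\ell_t(\theta)]$, where $\theta\mapsto\mathbb E_{t-1}[\ell_t(\theta)]$ is any version that is almost surely continuous on $\mathcal B_1$ (such versions exist). For $\theta,\theta'\in\mathcal B_1$ let $D(\theta,\theta')=\min\{0\le\pi\le1:\|\theta-(1-\pi)\theta'\|_1\le\pi\}$ and $D(\theta,\Theta_0)=\min_{\theta'\in\Theta_0}D(\theta,\theta')$. **Theorem 2.** There is a universal constant $C>0$ such that the following holds. Let $x>0$, let $\Theta_0\subset\mathcal B_1$ be finite and contain the $2d$ signed corners $\{\theta:\|\theta\|_1=1,\|\theta\|_0=1\}$ of the $\ell_1$-ball, and assume (A1), (A2), $E=8G/3\ge1$ and $GT\ge e$. Then the algorithm run with $\Theta_0$, the uniform prior $\hat\pi_{k,0}=1/K$ and $E=8G/3$ satisfies, with probability at least $1-e^{-x}$, simultaneously for all $\theta\in\mathcal B_1$, $$R_T(\theta)\le C\left(\Big(\frac a{\alpha T}\Big)^{\frac1{2-\beta}}+G\,D(\theta,\Theta_0)\sqrt{\frac aT}+\frac{aG}T\right),\qquad a=\log\mathrm{Card}(\Theta_0)+\log\log(GT)+x.$$ -/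

import Mathlib

open MeasureTheory

noncomputable section

/-- The `ℓ₁`-norm on `ℝ^d`. -/
def l1norm {d : ℕ} (θ : Fin d → ℝ) : ℝ := ∑ i, |θ i|

/-- The number of nonzero coordinates of a vector of `ℝ^d`. -/
def l0norm {d : ℕ} (θ : Fin d → ℝ) : ℕ := (Finset.univ.filter fun i => θ i ≠ 0).card

/-- The closed unit `ℓ₁`-ball of `ℝ^d`. -/
def l1Ball (d : ℕ) : Set (Fin d → ℝ) := {θ | l1norm θ ≤ 1}

/-! ### Averaging accelerability -/

/-- The set of `π ∈ [0,1]` with `‖θ - (1-π) θ'‖₁ ≤ π`. -/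
def accelSet {d : ℕ} (θ θ' : Fin d → ℝ) : Set ℝ :=
  {p | 0 ≤ p ∧ p ≤ 1 ∧ l1norm (θ - (1 - p) • θ') ≤ p}

/-- The averaging accelerability `D(θ,θ')` of two points. -/
def accel {d : ℕ} (θ θ' : Fin d → ℝ) : ℝ := sInf (accelSet θ θ')

/-- On the unit `ℓ₁`-ball the infimum defining `D(θ,θ')` is a minimum. -/
theorem isLeast_accel {d : ℕ} (θ θ' : Fin d → ℝ) (h : θ ∈ l1Ball d) :
    IsLeast (accelSet θ θ') (accel θ θ') := by
  have hc : IsCompact (accelSet θ θ') := by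
    have : accelSet θ θ' = Set.Icc 0 1 ∩ {p | l1norm (θ - (1 - p) • θ') ≤ p} := by
      ext p
      simp [accelSet, and_assoc]
    rw [this]
    refine isCompact_Icc.inter_right (isClosed_le ?_ continuous_id)
    unfold l1norm
    fun_prop
  refine hc.isLeast_sInf ⟨1, zero_le_one, le_rfl, ?_⟩
  simpa [l1Ball] using h

/-- `D(θ,Θ₀) = min_{θ' ∈ Θ₀} D(θ,θ')` for a finite nonempty grid `Θ₀`. -/
def gridAccel {d : ℕ} (θ : Fin d → ℝ) (grid : Finset (Fin d → ℝ)) : ℝ :=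
  ⨅ θ' : {θ' // θ' ∈ grid}, accel θ θ'.1

/-! ### The algorithm: Squint / BOA with several constant learning rates -/

/-- The number of learning rates: the integers `i` with `1 ≤ i ≤ log (E T)`. -/
def numRates (E : ℝ) (T : ℕ) : ℕ := ⌊Real.log (E * T)⌋₊

/-- The learning rate `η_i = (e^i E)⁻¹`. -/
def rate (E : ℝ) (i : ℕ) : ℝ := (Real.exp i * E)⁻¹

/-- The unnormalised weight `∑_i η_i exp(η_i S_{θ,i}) π₀(θ)` of the grid point `θ`, where
`S θ i` stands for the cumulative quantity `∑_s (r_{θ,s} - η_i r_{θ,s}²)`. -/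
def rawWeight {d : ℕ} (E : ℝ) (T : ℕ) (prior : (Fin d → ℝ) → ℝ)
    (S : (Fin d → ℝ) → ℕ → ℝ) (θ : Fin d → ℝ) : ℝ :=
  ∑ i ∈ Finset.Icc 1 (numRates E T), rate E i * Real.exp (rate E i * S θ i) * prior θ

/-- The prediction `∑_k π̂_k θ_k` with the normalised weights. -/
def predict {d : ℕ} (E : ℝ) (T : ℕ) (grid : Finset (Fin d → ℝ)) (prior : (Fin d → ℝ) → ℝ)
    (S : (Fin d → ℝ) → ℕ → ℝ) : Fin d → ℝ :=
  ∑ θ ∈ grid, (rawWeight E T prior S θ / ∑ θ' ∈ grid, rawWeight E T prior S θ') • θ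

/-- The cumulative quantities `S_{θ,i} = ∑_{s=1}^t (r_{θ,s} - η_i r_{θ,s}²)` after `t` rounds,
where `r_{θ,s} = ∇ℓ_s(θ̂_{s-1})ᵀ (θ̂_{s-1} - θ)` and `grad s` is the map `∇ℓ_s`. -/
def squintState {d : ℕ} (E : ℝ) (T : ℕ) (grid : Finset (Fin d → ℝ)) (prior : (Fin d → ℝ) → ℝ)
    (grad : ℕ → (Fin d → ℝ) → (Fin d → ℝ)) : ℕ → (Fin d → ℝ) → ℕ → ℝ
  | 0 => fun _ _ => 0
  | t + 1 => fun θ i =>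
      let S := squintState E T grid prior grad t
      let p := predict E T grid prior S
      let r := grad (t + 1) p ⬝ᵥ (p - θ)
      S θ i + (r - rate E i * r ^ 2)

/-- The point `θ̂_t` computed by the algorithm after `t` rounds: it is the prediction played in
round `t + 1`. At `t = 0` the weights are the normalised prior. -/
def squint {d : ℕ} (E : ℝ) (T : ℕ) (grid : Finset (Fin d → ℝ)) (prior : (Fin d → ℝ) → ℝ)
    (grad : ℕ → (Fin d → ℝ) → (Fin d → ℝ)) (t : ℕ) : Fin d → ℝ :=
  predict E T grid prior (squintState E T grid prior grad t)

/-- The uniform weight vector over a finite grid. -/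
def uniformPrior {d : ℕ} (grid : Finset (Fin d → ℝ)) : (Fin d → ℝ) → ℝ :=
  fun _ => (grid.card : ℝ)⁻¹

/-! ### Random losses and the assumptions -/

/-- Random convex losses `ℓ_t` (`t ≥ 1`) on `ℝ^d` with subgradients `∇ℓ_t(θ) = g t ω θ`, revealed
along the filtration `F` (round `t` is known at time `t`), with integrable values on the unit
`ℓ₁`-ball. -/
structure IsRandomConvexLoss {d : ℕ} {Ω : Type*} {m : MeasurableSpace Ω} (μ : Measure Ω)
    (F : Filtration ℕ m) (ℓ : ℕ → Ω → (Fin d → ℝ) → ℝ)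
    (g : ℕ → Ω → (Fin d → ℝ) → (Fin d → ℝ)) : Prop where
  convex : ∀ t, 1 ≤ t → ∀ ω, ConvexOn ℝ Set.univ (ℓ t ω)
  subgradient : ∀ t, 1 ≤ t → ∀ ω θ θ', ℓ t ω θ + g t ω θ ⬝ᵥ (θ' - θ) ≤ ℓ t ω θ'
  measurable_loss : ∀ t, 1 ≤ t → ∀ θ, Measurable[F t] fun ω => ℓ t ω θ
  measurable_grad : ∀ t, 1 ≤ t →
    Measurable[(F t).prod MeasurableSpace.pi] fun q : Ω × (Fin d → ℝ) => g t q.1 q.2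
  integrable : ∀ t, 1 ≤ t → ∀ θ ∈ l1Ball d, Integrable (fun ω => ℓ t ω θ) μ

/-- Lipschitz losses: the subgradients on the unit `ℓ₁`-ball are bounded by `G` in sup-norm. -/
def LipschitzLoss {d : ℕ} {Ω : Type*} {m : MeasurableSpace Ω} (μ : Measure Ω)
    (g : ℕ → Ω → (Fin d → ℝ) → (Fin d → ℝ)) (G : ℝ) : Prop :=
  ∀ᵐ ω ∂μ, ∀ t, 1 ≤ t → ∀ θ ∈ l1Ball d, ∀ i, |g t ω θ i| ≤ G

/-- `u ^ (1/β)` for `u ≥ 0`. For `β = 0` it is the limit as `β → 0⁺`, which is `0` for `u < 1`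
and `+∞` for `u > 1`; the infinite value is excluded separately in `WeakExpConcave`. -/
def powInv (u β : ℝ) : ℝ := if β = 0 then 0 else u ^ (1 / β)

/-- Weak exp-concavity with parameters `α`, `β`: for all `t ≥ 1` and `θ₁, θ₂` in the unit
`ℓ₁`-ball, almost surely, with `s = ∇ℓ_t(θ₁)ᵀ(θ₁ - θ₂)`,
`E_{t-1}[ℓ_t(θ₁) - ℓ_t(θ₂)] ≤ E_{t-1}[s] - E_{t-1}[(α s²)^{1/β}]`.
For `β = 0` this asks for `α s² ≤ 1`, so that the last expectation is finite. -/
def WeakExpConcave {d : ℕ} {Ω : Type*} {m : MeasurableSpace Ω} (μ : Measure Ω)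
    (F : Filtration ℕ m) (ℓ : ℕ → Ω → (Fin d → ℝ) → ℝ)
    (g : ℕ → Ω → (Fin d → ℝ) → (Fin d → ℝ)) (α β : ℝ) : Prop :=
  ∀ t, 1 ≤ t → ∀ θ₁ ∈ l1Ball d, ∀ θ₂ ∈ l1Ball d,
    (β = 0 → ∀ᵐ ω ∂μ, α * (g t ω θ₁ ⬝ᵥ (θ₁ - θ₂)) ^ 2 ≤ 1) ∧
    ∀ᵐ ω ∂μ,
      (μ[fun ω' => ℓ t ω' θ₁ - ℓ t ω' θ₂ | F (t - 1)]) ω ≤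
        (μ[fun ω' => g t ω' θ₁ ⬝ᵥ (θ₁ - θ₂) | F (t - 1)]) ω -
        (μ[fun ω' => powInv (α * (g t ω' θ₁ ⬝ᵥ (θ₁ - θ₂)) ^ 2) β | F (t - 1)]) ω

/-! ### Average risk -/

/-- `L t θ ω` is a regular version of the conditional risks `E_{t-1}[ℓ_t(θ)](ω)`: each `L t θ` is
a version of the conditional expectation, and almost every `θ ↦ L t θ ω` is continuous on the unit
`ℓ₁`-ball. Any two of them agree almost surely for all `θ` in the ball simultaneously. -/
def IsCondRisk {d : ℕ} {Ω : Type*} {m : MeasurableSpace Ω} (μ : Measure Ω)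
    (F : Filtration ℕ m) (ℓ : ℕ → Ω → (Fin d → ℝ) → ℝ)
    (L : ℕ → (Fin d → ℝ) → Ω → ℝ) : Prop :=
  (∀ t, 1 ≤ t → ∀ θ ∈ l1Ball d, L t θ =ᵐ[μ] μ[fun ω => ℓ t ω θ | F (t - 1)]) ∧
  ∀ᵐ ω ∂μ, ∀ t, 1 ≤ t → ContinuousOn (fun θ => L t θ ω) (l1Ball d)

/-- The average risk
`R_T(θ) = (1/T) ∑_{t=1}^T E_{t-1}[ℓ_t(θ̂_{t-1})] - (1/T) ∑_{t=1}^T E_{t-1}[ℓ_t(θ)]` of the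
predictions `pred t ω = θ̂_t`, where `L` is a version of the conditional risks. -/
def avgRisk {d : ℕ} {Ω : Type*} {m : MeasurableSpace Ω} (μ : Measure Ω)
    (F : Filtration ℕ m) (ℓ : ℕ → Ω → (Fin d → ℝ) → ℝ) (pred : ℕ → Ω → (Fin d → ℝ))
    (L : ℕ → (Fin d → ℝ) → Ω → ℝ) (T : ℕ) (θ : Fin d → ℝ) (ω : Ω) : ℝ :=
  1 / (T : ℝ) * ∑ t ∈ Finset.Icc 1 T, (μ[fun ω' => ℓ t ω' (pred (t - 1) ω') | F (t - 1)]) ω -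
    1 / (T : ℝ) * ∑ t ∈ Finset.Icc 1 T, L t θ ω

/-- The complexity term `a = log (Card Θ₀) + log log (G T) + x`. -/
def complexityTerm {d : ℕ} (grid : Finset (Fin d → ℝ)) (G : ℝ) (T : ℕ) (x : ℝ) : ℝ :=
  Real.log grid.card + Real.log (Real.log (G * T)) + x

end

/-! Write r for the linearised regret ∇ℓ(p)ᵀ(p - θ) of the prediction p. Weighted AM-GM
(`mul_le_powInv_add`) turns weak exp-concavity into a quadratic gain: the conditional excess loss is
at most E[r - ηr²] + ρ as soon as 4η ≤ αρ^(1-β). The hypothesis holds only at fixed points, off null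
sets that depend on them, whereas p is random and the subgradient need not be continuous.
`IsRandomConvexLoss.surrogate_le` therefore moves p slightly towards θ and uses monotonicity of the
subgradient; the factor 4 is the price.

On the algorithmic side, the potential Σ π exp(ηS) never increases (`potential_le`), so ηS is at
most the logarithm of the number of pairs (grid point, rate). A supermartingale argument
(`integral_exp_sum_expIncrement_le_one`) converts this pathwise bound into one on the sum of E[r -
4ηr²], outside an event of probability e^(-x) and for all pairs at once (`exists_regret_event`). The
number of rates enters only through its logarithm, hence the term log log(GT).

A point at accelerability π is (1 - π)k + πξ with k in the grid and ξ in the ball, and ξ is a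
mixture of signed corners. The regret to k is controlled with a fast rate c₁ and the regret to the
corners with a slow rate c₂ of order s/G, where s² = a/T. Up to constants, `condRegret_le` then pays
ρ + s²/c₁ + π(s²/c₂ + c₂G²) + c₁π²G². Taking c₁ near the minimum of s²/ρ, 1/G and s/(Gπ), with
αρ^(2-β) = a/T, gives ρ + Gπs + Gs². Continuity in (π, ξ), for each of the finitely many k, makes
the bound uniform in θ. -/

/-! ### The `ℓ₁`-norm -/

section L1

variable {d : ℕ}

lemma l1norm_nonneg (v : Fin d → ℝ) : 0 ≤ l1norm v :=
  Finset.sum_nonneg fun _ _ => abs_nonneg _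

lemma l1norm_add_le (v w : Fin d → ℝ) : l1norm (v + w) ≤ l1norm v + l1norm w := by
  unfold l1norm
  rw [← Finset.sum_add_distrib]
  exact Finset.sum_le_sum fun i _ => abs_add_le _ _

lemma l1norm_smul (c : ℝ) (v : Fin d → ℝ) : l1norm (c • v) = |c| * l1norm v := by
  simp [l1norm, abs_mul, Finset.mul_sum]

lemma l1norm_neg (v : Fin d → ℝ) : l1norm (-v) = l1norm v := by
  simp [l1norm]

lemma l1norm_sub_le (v w : Fin d → ℝ) : l1norm (v - w) ≤ l1norm v + l1norm w := by
  rw [sub_eq_add_neg, ← l1norm_neg w]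
  exact l1norm_add_le _ _

lemma l1norm_sub_le_two {v w : Fin d → ℝ} (hv : v ∈ l1Ball d) (hw : w ∈ l1Ball d) :
    l1norm (v - w) ≤ 2 := by
  have h1 : l1norm v ≤ 1 := hv
  have h2 : l1norm w ≤ 1 := hw
  linarith [l1norm_sub_le v w]

lemma zero_mem_l1Ball : (0 : Fin d → ℝ) ∈ l1Ball d := by
  simp [l1Ball, l1norm]

lemma continuous_l1norm : Continuous (l1norm (d := d)) := by
  unfold l1norm
  fun_prop

lemma l1norm_le_mul_norm (v : Fin d → ℝ) : l1norm v ≤ d * ‖v‖ := by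
  unfold l1norm
  calc ∑ i, |v i| ≤ ∑ _i : Fin d, ‖v‖ := Finset.sum_le_sum fun i _ => norm_le_pi_norm v i
    _ = d * ‖v‖ := by simp

lemma convex_l1Ball : Convex ℝ (l1Ball d) := by
  intro v hv w hw a b ha hb hab
  have h1 : l1norm v ≤ 1 := hv
  have h2 : l1norm w ≤ 1 := hw
  change l1norm (a • v + b • w) ≤ 1
  have := l1norm_add_le (a • v) (b • w)
  rw [l1norm_smul, l1norm_smul, abs_of_nonneg ha, abs_of_nonneg hb] at this
  nlinarith

lemma abs_dotProduct_le {G : ℝ} {h : Fin d → ℝ} (hG : ∀ i, |h i| ≤ G) (v : Fin d → ℝ) :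
    |h ⬝ᵥ v| ≤ G * l1norm v := by
  unfold l1norm dotProduct
  rw [Finset.mul_sum]
  refine (Finset.abs_sum_le_sum_abs _ _).trans (Finset.sum_le_sum fun i _ => ?_)
  rw [abs_mul]
  exact mul_le_mul_of_nonneg_right (hG i) (abs_nonneg _)

/-- The signed corners of the `ℓ₁`-ball span it. -/
lemma l1Ball_subset_convexHull (hd : 0 < d) {grid : Finset (Fin d → ℝ)}
    (hgrid : ∀ θ : Fin d → ℝ, l1norm θ = 1 → l0norm θ = 1 → θ ∈ grid) :
    l1Ball d ⊆ convexHull ℝ (grid : Set (Fin d → ℝ)) := by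
  intro ξ hξ
  have hξ1 : l1norm ξ ≤ 1 := hξ
  have hcorner : ∀ (i : Fin d) (c : ℝ), |c| = 1 → Pi.single i c ∈ grid := by
    intro i c hc
    have hc0 : c ≠ 0 := by rintro rfl; simp at hc
    apply hgrid
    · unfold l1norm
      rw [Finset.sum_eq_single i] <;> simp +contextual [hc]
    · unfold l0norm
      rw [Finset.card_eq_one]
      refine ⟨i, ?_⟩
      ext j
      by_cases h : j = i <;> simp [Pi.single_apply, h, hc0]
  have hd' : (0 : ℝ) < d := by exact_mod_cast hd
  -- Positive and negative parts of ξ, plus the missing mass 1 - ‖ξ‖₁ spread evenly over antipodal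
  -- corners, where it cancels.
  let w : Fin d ⊕ Fin d → ℝ := Sum.elim (fun i => (|ξ i| + ξ i) / 2 + (1 - l1norm ξ) / (2 * d))
    (fun i => (|ξ i| - ξ i) / 2 + (1 - l1norm ξ) / (2 * d))
  let z : Fin d ⊕ Fin d → (Fin d → ℝ) := Sum.elim (fun i => Pi.single i 1) (fun i => Pi.single i (-1))
  have hrest : 0 ≤ (1 - l1norm ξ) / (2 * d) := by
    apply div_nonneg <;> linarith
  have hw0 : ∀ j ∈ Finset.univ, 0 ≤ w j := by
    rintro (i | i) -
    · simp only [w, Sum.elim_inl]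
      linarith [neg_abs_le (ξ i)]
    · simp only [w, Sum.elim_inr]
      linarith [le_abs_self (ξ i)]
  have hw1 : ∑ j, w j = 1 := by
    rw [Fintype.sum_sum_type]
    simp only [w, Sum.elim_inl, Sum.elim_inr]
    rw [← Finset.sum_add_distrib]
    have : ∀ i : Fin d, (|ξ i| + ξ i) / 2 + (1 - l1norm ξ) / (2 * d) +
        ((|ξ i| - ξ i) / 2 + (1 - l1norm ξ) / (2 * d)) = |ξ i| + (1 - l1norm ξ) / d := by
      intro i; field_simp; ring
    simp only [this]
    rw [Finset.sum_add_distrib]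
    simp only [Finset.sum_const, Finset.card_univ, Fintype.card_fin, nsmul_eq_mul]
    rw [mul_div_cancel₀ _ hd'.ne']
    simp [l1norm]
  have hsum : ∑ j, w j • z j = ξ := by
    rw [Fintype.sum_sum_type]
    simp only [w, z, Sum.elim_inl, Sum.elim_inr]
    rw [← Finset.sum_add_distrib]
    ext k
    simp only [Finset.sum_apply, Pi.add_apply, Pi.smul_apply, smul_eq_mul]
    rw [Finset.sum_eq_single k]
    · simp; ring
    · intro b _ hb
      simp [hb.symm]
    · simp
  rw [← hsum]
  refine (convex_convexHull ℝ _).sum_mem hw0 hw1 ?_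
  rintro (i | i) - <;> apply subset_convexHull
  · exact hcorner i 1 (by simp)
  · exact hcorner i (-1) (by simp)

/-- A point at accelerability `p` from the grid is a convex combination of a grid point, with
weight `1 - p`, and a point of the ball, with weight `p`. -/
lemma exists_eq_of_gridAccel {grid : Finset (Fin d → ℝ)} (hne : grid.Nonempty) {θ : Fin d → ℝ}
    (hθ : θ ∈ l1Ball d) :
    ∃ θ' ∈ grid, ∃ ξ ∈ l1Ball d, gridAccel θ grid ∈ Set.Icc (0 : ℝ) 1 ∧
      θ = (1 - gridAccel θ grid) • θ' + gridAccel θ grid • ξ := by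
  have : Nonempty {θ' // θ' ∈ grid} := hne.to_subtype
  obtain ⟨⟨θ', hθ'⟩, h⟩ := exists_eq_ciInf_of_finite (f := fun θ' : {θ' // θ' ∈ grid} => accel θ θ'.1)
  change accel θ θ' = gridAccel θ grid at h
  rw [← h]
  obtain ⟨h0, h1, h2⟩ := (isLeast_accel θ θ' hθ).1
  rcases h0.eq_or_lt with hp | hp
  · refine ⟨θ', hθ', 0, zero_mem_l1Ball, ⟨h0, h1⟩, ?_⟩
    rw [← hp] at h2 ⊢
    have h3 : l1norm (θ - (1 - (0 : ℝ)) • θ') = 0 := le_antisymm h2 (l1norm_nonneg _)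
    unfold l1norm at h3
    rw [Finset.sum_eq_zero_iff_of_nonneg fun _ _ => abs_nonneg _] at h3
    ext i
    have := h3 i (Finset.mem_univ _)
    simp at this ⊢
    linarith
  · refine ⟨θ', hθ', (accel θ θ')⁻¹ • (θ - (1 - accel θ θ') • θ'), ?_, ⟨h0, h1⟩, ?_⟩
    · change l1norm _ ≤ 1
      rw [l1norm_smul, abs_of_pos (inv_pos.2 hp)]
      rw [inv_mul_le_iff₀ hp]
      simpa using h2
    · rw [smul_smul, mul_inv_cancel₀ hp.ne', one_smul]
      abel

end L1

/-! ### Scalar inequalities -/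

/-- Linearisation of the power in the weak exp-concavity condition. -/
lemma mul_le_powInv_add {α β ρ v : ℝ} (hα : 0 < α) (hβ0 : 0 ≤ β) (hβ1 : β ≤ 1) (hρ : 0 < ρ)
    (hv : 0 ≤ v) (h : β = 0 → α * v ≤ 1) :
    α * ρ ^ (1 - β) * v ≤ powInv (α * v) β + ρ := by
  unfold powInv
  split_ifs with hβ
  · subst hβ
    have := h rfl
    simp only [sub_zero, Real.rpow_one]
    nlinarith
  · have hβ' : 0 < β := lt_of_le_of_ne hβ0 (Ne.symm hβ)
    have hav : 0 ≤ α * v := by positivity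
    have hz : 0 ≤ (α * v) ^ (1 / β) := Real.rpow_nonneg hav _
    -- AM-GM with weights β and 1 - β for (αv)^(1/β) and ρ: the geometric mean is αv·ρ^(1-β).
    have key := Real.geom_mean_le_arith_mean2_weighted hβ0 (sub_nonneg.2 hβ1) hz hρ.le (by ring)
    rw [← Real.rpow_mul hav, one_div, inv_mul_cancel₀ hβ, Real.rpow_one] at key
    rw [one_div] at hz ⊢
    nlinarith

/-- Passing from a subgradient at a nearby point (`u`) to the one at the point itself (`s`). -/
lemma sub_sq_le_of_le_add {u s e η M : ℝ} (hu : |u| ≤ M) (hs : |s| ≤ M) (he : 0 ≤ e) (hη : 0 ≤ η)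
    (hM : 4 * M * η ≤ 1) (h : u ≤ s + e) : u - 4 * η * u ^ 2 ≤ s - η * s ^ 2 + 2 * e := by
  have hM0 : 0 ≤ M := (abs_nonneg u).trans hu
  obtain ⟨hu1, hu2⟩ := abs_le.1 hu
  obtain ⟨hs1, hs2⟩ := abs_le.1 hs
  have hηu : 0 ≤ η * u ^ 2 := by positivity
  rcases le_total u s with hus | hus
  -- If s² ≤ 4u², the factor 4 on the left pays for ηs². Otherwise s ≥ 0 and 2u ≤ s, while ηs² ≤ ηMs
  -- ≤ s/4, so s - ηs² ≥ 3s/4 ≥ u.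
  · rcases le_total (s ^ 2) (4 * u ^ 2) with hsq | hsq
    · nlinarith
    · have hs0 : 0 ≤ s := by
        by_contra hneg
        push Not at hneg
        nlinarith
      have h2 : 2 * u ≤ s := by nlinarith
      have : η * s ^ 2 ≤ η * M * s := by
        have := mul_le_mul_of_nonneg_left hs2 (mul_nonneg hη hs0)
        nlinarith
      nlinarith
  · have h3 : η * (s ^ 2 - u ^ 2) ≤ e := by
      have e1 : s ^ 2 - u ^ 2 = (u - s) * (-(u + s)) := by ring
      have e2 : -(u + s) ≤ 2 * M := by linarith
      have e3 : s ^ 2 - u ^ 2 ≤ (u - s) * (2 * M) := by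
        rw [e1]; exact mul_le_mul_of_nonneg_left e2 (by linarith)
      have e4 : η * (s ^ 2 - u ^ 2) ≤ η * ((u - s) * (2 * M)) := mul_le_mul_of_nonneg_left e3 hη
      nlinarith
    nlinarith

/-- Makes each round of the potential linear in the regret, so that averaging with the weights
annihilates it. -/
lemma exp_sub_sq_le {X : ℝ} (hX : |X| ≤ 2 / 5) : Real.exp (X - X ^ 2) ≤ 1 + X := by
  obtain ⟨h1, h2⟩ := abs_le.1 hX
  rcases le_total 0 X with h0 | h0
  · have hy : |X - X ^ 2| ≤ 1 := by rw [abs_le]; constructor <;> nlinarith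
    have := (abs_le.1 (Real.abs_exp_sub_one_sub_id_le hy)).2
    have h3 : (X - X ^ 2) ^ 2 ≤ X ^ 2 := by
      rw [show (X - X ^ 2) ^ 2 = X ^ 2 * (1 - X) ^ 2 by ring]
      exact mul_le_of_le_one_right (sq_nonneg X) (by nlinarith)
    linarith
  · have hz : 0 ≤ X ^ 2 - X := by nlinarith
    have h3 := Real.quadratic_le_exp_of_nonneg hz
    rw [show X - X ^ 2 = -(X ^ 2 - X) by ring, Real.exp_neg]
    rw [inv_le_iff_one_le_mul₀ (Real.exp_pos _)]
    have h4 : 1 ≤ (1 + X) * (1 + (X ^ 2 - X) + (X ^ 2 - X) ^ 2 / 2) := by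
      have : (1 + X) * (1 + (X ^ 2 - X) + (X ^ 2 - X) ^ 2 / 2) - 1
        = X ^ 2 * ((1 - X) ^ 2 * (1 + X) / 2 + X) := by ring
      have h5 : 0 ≤ (1 - X) ^ 2 * (1 + X) / 2 + X := by nlinarith [mul_nonneg (neg_nonneg.2 h0) (neg_nonneg.2 h0)]
      nlinarith [mul_nonneg (sq_nonneg X) h5]
    have := mul_le_mul_of_nonneg_left h3 (show 0 ≤ 1 + X by linarith)
    linarith

/-- The opposite sign, needed for the supermartingale. The 4 is 1 from the exponent plus 3 ≥ (1 -
X)² from the Taylor remainder; it is the source of the form r - 4ηr² of the conditional regret. -/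
lemma exp_sq_sub_le {X : ℝ} (hX : |X| ≤ 1 / 2) : Real.exp (X ^ 2 - X) ≤ 1 - X + 4 * X ^ 2 := by
  obtain ⟨h1, h2⟩ := abs_le.1 hX
  have hy : |X ^ 2 - X| ≤ 1 := by rw [abs_le]; constructor <;> nlinarith
  have := (abs_le.1 (Real.abs_exp_sub_one_sub_id_le hy)).2
  have h3 : (X ^ 2 - X) ^ 2 ≤ 3 * X ^ 2 := by
    have : (X ^ 2 - X) ^ 2 = X ^ 2 * (1 - X) ^ 2 := by ring
    rw [this, mul_comm]
    exact mul_le_mul_of_nonneg_right (by nlinarith) (sq_nonneg X)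
  linarith

/-- Second-order quantities of a convex combination `(1 - p) r + p q` with `p ≤ 1 / 2`. -/
lemma sub_sq_convexComb_le {r q p η G : ℝ} (hp0 : 0 ≤ p) (hp : p ≤ 1 / 2) (hη : 0 ≤ η)
    (hq : |q| ≤ 2 * G) :
    ((1 - p) * r + p * q) - 32 * η * ((1 - p) * r + p * q) ^ 2 ≤
      (1 - p) * (r - 4 * η * r ^ 2) + p * q + 128 * η * p ^ 2 * G ^ 2 := by
  have hq2 : q ^ 2 ≤ 4 * G ^ 2 := by
    have := sq_le_sq' (by linarith [(abs_le.1 hq).1]) (abs_le.1 hq).2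
    linarith
  -- (A + B)² ≥ A²/2 - B² with (1 - p)² ≥ 1/4 and |q| ≤ 2G. Multiplication by 32η produces the
  -- constants 4 and 128.
  have h1 : r ^ 2 / 8 - 4 * p ^ 2 * G ^ 2 ≤ ((1 - p) * r + p * q) ^ 2 := by
    have e1 : ((1 - p) * r) ^ 2 / 2 - (p * q) ^ 2 ≤ ((1 - p) * r + p * q) ^ 2 := by
      nlinarith [sq_nonneg ((1 - p) * r + 2 * (p * q))]
    have e2 : r ^ 2 / 4 ≤ ((1 - p) * r) ^ 2 := by
      have := mul_le_mul_of_nonneg_right (show 1 / 4 ≤ (1 - p) ^ 2 by nlinarith) (sq_nonneg r)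
      rw [mul_pow]
      linarith
    have e3 : (p * q) ^ 2 ≤ p ^ 2 * (4 * G ^ 2) := by
      rw [mul_pow]
      exact mul_le_mul_of_nonneg_left hq2 (sq_nonneg p)
    linarith
  have h2 := mul_le_mul_of_nonneg_left h1 hη
  have h3 : 0 ≤ p * (η * r ^ 2) := by positivity
  nlinarith

/-! ### The learning rates -/

lemma rate_pos {E : ℝ} (hE : 0 < E) (i : ℕ) : 0 < rate E i := by
  unfold rate; positivity

lemma rate_le {E : ℝ} (hE : 0 < E) {i : ℕ} (hi : 1 ≤ i) : rate E i ≤ (Real.exp 1 * E)⁻¹ := by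
  unfold rate
  have : (1 : ℝ) ≤ i := by exact_mod_cast hi
  gcongr

lemma rate_succ {E : ℝ} (i : ℕ) : rate E i = Real.exp 1 * rate E (i + 1) := by
  unfold rate
  push_cast
  rw [Real.exp_add]
  have := Real.exp_pos 1
  field_simp

lemma one_le_numRates {E : ℝ} {T : ℕ} (h : Real.exp 1 ≤ E * T) : 1 ≤ numRates E T := by
  unfold numRates
  apply Nat.le_floor
  rw [Nat.cast_one, Real.le_log_iff_exp_le ((Real.exp_pos 1).trans_le h)]
  exact h

lemma rate_numRates_le {E : ℝ} {T : ℕ} (hE : 1 ≤ E) (h : Real.exp 1 ≤ E * T) :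
    rate E (numRates E T) ≤ Real.exp 1 / (E * T) := by
  have hET : 0 < E * T := (Real.exp_pos 1).trans_le h
  have h1 : Real.log (E * T) - 1 < numRates E T := Nat.sub_one_lt_floor _
  have h2 : E * T ≤ Real.exp 1 * Real.exp (numRates E T) := by
    rw [← Real.exp_add, ← Real.log_le_iff_le_exp hET]
    linarith
  have h3 := Real.exp_pos (numRates E T)
  unfold rate
  rw [inv_eq_one_div, div_le_div_iff₀ (by positivity) hET]
  nlinarith [mul_pos (Real.exp_pos 1) h3]

/-- The learning rates form a geometric grid. -/
lemma exists_rate {E η : ℝ} {T : ℕ} (hE : 1 ≤ E) (h : Real.exp 1 ≤ E * T)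
    (hη : Real.exp 1 / (E * T) ≤ η) :
    ∃ i ∈ Finset.Icc 1 (numRates E T), rate E i ≤ η ∧
      1 / rate E i ≤ Real.exp 1 / η + Real.exp 1 * E := by
  have hE0 : 0 < E := by linarith
  have hET : 0 < E * T := (Real.exp_pos 1).trans_le h
  have hη0 : 0 < η := lt_of_lt_of_le (by positivity) hη
  have hex : ∃ i, 1 ≤ i ∧ rate E i ≤ η :=
    ⟨_, one_le_numRates h, (rate_numRates_le hE h).trans hη⟩
  classical
  set i := Nat.find hex with hi
  obtain ⟨hi1, hi2⟩ := Nat.find_spec hex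
  refine ⟨i, Finset.mem_Icc.2 ⟨hi1, Nat.find_le ⟨one_le_numRates h,
    (rate_numRates_le hE h).trans hη⟩⟩, hi2, ?_⟩
  -- For the least admissible index, either it is 1, which costs the additive term e·E, or the
  -- preceding rate exceeds η, which costs a factor e.
  rcases hi1.eq_or_lt with h1 | h1
  · have : 1 / rate E i = Real.exp 1 * E := by
      rw [hi, ← h1]; simp [rate]
    rw [this]
    have : 0 < Real.exp 1 / η := by positivity
    linarith
  · have hlt : η < rate E (i - 1) := by
      have := Nat.find_min hex (m := i - 1) (by omega)
      push Not at this
      exact this (by omega)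
    rw [rate_succ, Nat.sub_add_cancel (by omega)] at hlt
    have hr := rate_pos hE0 i
    have : 1 / rate E i ≤ Real.exp 1 / η := by
      rw [div_le_div_iff₀ hr hη0]; linarith
    have : 0 < Real.exp 1 * E := by positivity
    linarith

/-! ### Deterministic regret of the algorithm -/

section Squint

variable {d : ℕ}

lemma rawWeight_pos {E : ℝ} {T : ℕ} (hE : 0 < E) (hN : 1 ≤ numRates E T)
    {prior : (Fin d → ℝ) → ℝ} (hprior : ∀ θ, 0 < prior θ) (S : (Fin d → ℝ) → ℕ → ℝ)
    (θ : Fin d → ℝ) : 0 < rawWeight E T prior S θ :=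
  Finset.sum_pos (fun i _ => mul_pos (mul_pos (rate_pos hE i) (Real.exp_pos _)) (hprior θ))
    ⟨1, by simpa using hN⟩

lemma predict_mem {E : ℝ} {T : ℕ} (hE : 0 < E) (hN : 1 ≤ numRates E T)
    {grid : Finset (Fin d → ℝ)} (hne : grid.Nonempty) (hgrid : ∀ θ ∈ grid, θ ∈ l1Ball d)
    {prior : (Fin d → ℝ) → ℝ} (hprior : ∀ θ, 0 < prior θ) (S : (Fin d → ℝ) → ℕ → ℝ) :
    predict E T grid prior S ∈ l1Ball d := by
  have hpos := rawWeight_pos hE hN hprior S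
  have hsum : 0 < ∑ θ' ∈ grid, rawWeight E T prior S θ' := Finset.sum_pos (fun θ _ => hpos θ) hne
  refine convex_l1Ball.sum_mem (fun θ _ => (div_pos (hpos θ) hsum).le) ?_ hgrid
  rw [← Finset.sum_div, div_self hsum.ne']

/-- The prediction is the barycentre of the grid for exactly these weights. The extra factor η_i in
the weights is what makes this sum the first-order term of the potential. -/
lemma sum_rawWeight_mul_eq_zero {E : ℝ} {T : ℕ} (hE : 0 < E) (hN : 1 ≤ numRates E T)
    {grid : Finset (Fin d → ℝ)} (hne : grid.Nonempty)
    {prior : (Fin d → ℝ) → ℝ} (hprior : ∀ θ, 0 < prior θ) (S : (Fin d → ℝ) → ℕ → ℝ)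
    (h : Fin d → ℝ) :
    ∑ θ ∈ grid, rawWeight E T prior S θ * (h ⬝ᵥ (predict E T grid prior S - θ)) = 0 := by
  have hpos := rawWeight_pos hE hN hprior S
  have hsum : 0 < ∑ θ' ∈ grid, rawWeight E T prior S θ' := Finset.sum_pos (fun θ _ => hpos θ) hne
  have h1 : h ⬝ᵥ predict E T grid prior S =
      (∑ θ ∈ grid, rawWeight E T prior S θ * (h ⬝ᵥ θ)) / ∑ θ' ∈ grid, rawWeight E T prior S θ' := by
    unfold predict
    rw [dotProduct_sum, Finset.sum_div]
    refine Finset.sum_congr rfl fun θ _ => ?_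
    rw [dotProduct_smul, smul_eq_mul]
    ring
  simp only [dotProduct_sub, mul_sub, Finset.sum_sub_distrib]
  rw [← Finset.sum_mul, h1, mul_div_cancel₀ _ hsum.ne', sub_self]

/-- The potential of the algorithm does not increase. -/
lemma potential_le {E : ℝ} {T : ℕ} (hE : 0 < E) (hN : 1 ≤ numRates E T)
    {grid : Finset (Fin d → ℝ)} (hne : grid.Nonempty)
    {prior : (Fin d → ℝ) → ℝ} (hprior : ∀ θ, 0 < prior θ)
    (grad : ℕ → (Fin d → ℝ) → (Fin d → ℝ)) (n : ℕ)
    (hb : ∀ t < n, ∀ θ ∈ grid, ∀ i ∈ Finset.Icc 1 (numRates E T),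
      |rate E i * (grad (t + 1) (squint E T grid prior grad t) ⬝ᵥ
        (squint E T grid prior grad t - θ))| ≤ 2 / 5) :
    ∑ θ ∈ grid, ∑ i ∈ Finset.Icc 1 (numRates E T),
      prior θ * Real.exp (rate E i * squintState E T grid prior grad n θ i) ≤
    numRates E T * ∑ θ ∈ grid, prior θ := by
  induction n with
  | zero => simp [squintState, Finset.mul_sum]
  | succ t ih =>
    refine le_trans ?_ (ih fun s hs => hb s (hs.trans (Nat.lt_succ_self t)))
    set S := squintState E T grid prior grad t with hS
    set p := predict E T grid prior S with hp
    have hbt := hb t (Nat.lt_succ_self t)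
    change ∀ θ ∈ grid, ∀ i ∈ Finset.Icc 1 (numRates E T),
      |rate E i * (grad (t + 1) p ⬝ᵥ (p - θ))| ≤ 2 / 5 at hbt
    have hstep : ∀ θ ∈ grid, ∀ i ∈ Finset.Icc 1 (numRates E T),
        prior θ * Real.exp (rate E i * squintState E T grid prior grad (t + 1) θ i) ≤
        prior θ * Real.exp (rate E i * S θ i) +
          rate E i * Real.exp (rate E i * S θ i) * prior θ * (grad (t + 1) p ⬝ᵥ (p - θ)) := by
      intro θ hθ i hi
      set r := grad (t + 1) p ⬝ᵥ (p - θ) with hr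
      have h1 : squintState E T grid prior grad (t + 1) θ i = S θ i + (r - rate E i * r ^ 2) := rfl
      have h2 : rate E i * (S θ i + (r - rate E i * r ^ 2)) =
          rate E i * S θ i + (rate E i * r - (rate E i * r) ^ 2) := by ring
      rw [h1, h2, Real.exp_add]
      have h3 := exp_sub_sq_le (hbt θ hθ i hi)
      have h4 := mul_le_mul_of_nonneg_left h3
        (mul_pos (hprior θ) (Real.exp_pos (rate E i * S θ i))).le
      linarith
    calc _ ≤ ∑ θ ∈ grid, ∑ i ∈ Finset.Icc 1 (numRates E T),
          (prior θ * Real.exp (rate E i * S θ i) +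
          rate E i * Real.exp (rate E i * S θ i) * prior θ * (grad (t + 1) p ⬝ᵥ (p - θ))) :=
        Finset.sum_le_sum fun θ hθ => Finset.sum_le_sum fun i hi => hstep θ hθ i hi
      _ = (∑ θ ∈ grid, ∑ i ∈ Finset.Icc 1 (numRates E T),
          prior θ * Real.exp (rate E i * S θ i)) +
          ∑ θ ∈ grid, rawWeight E T prior S θ * (grad (t + 1) p ⬝ᵥ (p - θ)) := by
        simp only [Finset.sum_add_distrib, rawWeight, Finset.sum_mul]
      _ = _ := by
        rw [sum_rawWeight_mul_eq_zero hE hN hne hprior S, add_zero]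

lemma uniformPrior_pos {grid : Finset (Fin d → ℝ)} (hne : grid.Nonempty) (θ : Fin d → ℝ) :
    0 < uniformPrior grid θ := by
  have : 0 < grid.card := hne.card_pos
  unfold uniformPrior
  positivity

/-- Second-order regret bound, for all grid points and all learning rates. -/
lemma rate_mul_squintState_le {E : ℝ} {T : ℕ} (hE : 0 < E) (hN : 1 ≤ numRates E T)
    {grid : Finset (Fin d → ℝ)} (grad : ℕ → (Fin d → ℝ) → (Fin d → ℝ)) (n : ℕ)
    (hb : ∀ t < n, ∀ θ ∈ grid, ∀ i ∈ Finset.Icc 1 (numRates E T),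
      |rate E i * (grad (t + 1) (squint E T grid (uniformPrior grid) grad t) ⬝ᵥ
        (squint E T grid (uniformPrior grid) grad t - θ))| ≤ 2 / 5)
    {θ : Fin d → ℝ} (hθ : θ ∈ grid) {i : ℕ} (hi : i ∈ Finset.Icc 1 (numRates E T)) :
    rate E i * squintState E T grid (uniformPrior grid) grad n θ i ≤
      Real.log (grid.card * numRates E T) := by
  have hne : grid.Nonempty := ⟨θ, hθ⟩
  have hcard : (0 : ℝ) < grid.card := by exact_mod_cast hne.card_pos
  have hN' : (0 : ℝ) < numRates E T := by exact_mod_cast hN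
  have h1 := potential_le hE hN hne (uniformPrior_pos hne) grad n hb
  have h2 : ∑ θ ∈ grid, uniformPrior grid θ = 1 := by
    simp [uniformPrior, hcard.ne']
  rw [h2, mul_one] at h1
  have hnn : ∀ θ i, 0 ≤ uniformPrior grid θ *
      Real.exp (rate E i * squintState E T grid (uniformPrior grid) grad n θ i) :=
    fun θ i => mul_nonneg (uniformPrior_pos hne θ).le (Real.exp_pos _).le
  have h3 := Finset.single_le_sum (fun θ _ => Finset.sum_nonneg fun i (_ : i ∈ Finset.Icc 1 (numRates E T)) => hnn θ i) hθ
  have h4 := Finset.single_le_sum (fun i _ => hnn θ i) hi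
  have h5 := (h4.trans h3).trans h1
  rw [Real.le_log_iff_exp_le (by positivity)]
  unfold uniformPrior at h5 ⊢
  rwa [inv_mul_le_iff₀ hcard] at h5

lemma squintState_eq_sum {E : ℝ} {T : ℕ} {grid : Finset (Fin d → ℝ)} {prior : (Fin d → ℝ) → ℝ}
    (grad : ℕ → (Fin d → ℝ) → (Fin d → ℝ)) (n : ℕ) (θ : Fin d → ℝ) (i : ℕ) :
    squintState E T grid prior grad n θ i = ∑ t ∈ Finset.range n,
      (grad (t + 1) (squint E T grid prior grad t) ⬝ᵥ (squint E T grid prior grad t - θ) -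
        rate E i * (grad (t + 1) (squint E T grid prior grad t) ⬝ᵥ
          (squint E T grid prior grad t - θ)) ^ 2) := by
  induction n with
  | zero => rfl
  | succ n ih => rw [Finset.sum_range_succ, ← ih]; rfl

end Squint

/-! ### Exponential supermartingales -/

section Supermartingale

variable {Ω : Type*} {m : MeasurableSpace Ω} {μ : Measure Ω} {F : Filtration ℕ m}

lemma integrable_of_abs_le [IsFiniteMeasure μ] {f : Ω → ℝ} (hf : AEStronglyMeasurable f μ) {C : ℝ}
    (h : ∀ᵐ ω ∂μ, |f ω| ≤ C) : Integrable f μ :=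
  Integrable.of_bound hf C h

/-- The compensated exponent of one round. -/
noncomputable def expIncrement (μ : Measure Ω) (F : Filtration ℕ m) (X : ℕ → Ω → ℝ) (t : ℕ) (ω : Ω) : ℝ :=
  (μ[fun ω' => X t ω' - 4 * X t ω' ^ 2 | F t]) ω - X t ω + X t ω ^ 2

lemma abs_expIncrement_le {X : ℕ → Ω → ℝ} (hb : ∀ t, ∀ᵐ ω ∂μ, |X t ω| ≤ 1 / 2) (t : ℕ) :
    ∀ᵐ ω ∂μ, |(μ[fun ω' => X t ω' - 4 * X t ω' ^ 2 | F t]) ω| ≤ 3 / 2 ∧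
      |expIncrement μ F X t ω| ≤ 3 := by
  have h1 : ∀ᵐ ω ∂μ, |X t ω - 4 * X t ω ^ 2| ≤ 3 / 2 := by
    filter_upwards [hb t] with ω hω
    obtain ⟨h1, h2⟩ := abs_le.1 hω
    rw [abs_le]; constructor <;> nlinarith
  filter_upwards [hb t, ae_bdd_abs_condExp_of_ae_bdd_abs (m := F t) h1] with ω hω hc
  refine ⟨hc, ?_⟩
  obtain ⟨h1, h2⟩ := abs_le.1 hω
  obtain ⟨h3, h4⟩ := abs_le.1 hc
  unfold expIncrement
  rw [abs_le]; constructor <;> nlinarith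

lemma stronglyMeasurable_sum_expIncrement {X : ℕ → Ω → ℝ}
    (hX : ∀ t, StronglyMeasurable[F (t + 1)] (X t)) (n : ℕ) :
    StronglyMeasurable[F n] fun ω => ∑ t ∈ Finset.range n, expIncrement μ F X t ω := by
  refine Finset.stronglyMeasurable_fun_sum _ fun t ht => ?_
  have ht' : t + 1 ≤ n := Finset.mem_range.1 ht
  have h1 : StronglyMeasurable[F n] (X t) := (hX t).mono (F.mono ht')
  have h2 : StronglyMeasurable[F n] (μ[fun ω' => X t ω' - 4 * X t ω' ^ 2 | F t]) :=
    stronglyMeasurable_condExp.mono (F.mono (by omega))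
  exact (h2.sub h1).add (h1.pow 2)

lemma integrable_exp_sum_expIncrement [IsFiniteMeasure μ] {X : ℕ → Ω → ℝ}
    (hX : ∀ t, StronglyMeasurable[F (t + 1)] (X t)) (hb : ∀ t, ∀ᵐ ω ∂μ, |X t ω| ≤ 1 / 2)
    (n : ℕ) :
    Integrable (fun ω => Real.exp (∑ t ∈ Finset.range n, expIncrement μ F X t ω)) μ := by
  have hm := (stronglyMeasurable_sum_expIncrement (μ := μ) hX n).mono (F.le n)
  refine integrable_of_abs_le (Real.continuous_exp.comp_stronglyMeasurable hm).aestronglyMeasurable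
    (C := Real.exp (n * 3)) ?_
  filter_upwards [ae_all_iff.2 (abs_expIncrement_le (F := F) hb)] with ω hω
  rw [Real.abs_exp]
  apply Real.exp_le_exp.2
  calc _ ≤ ∑ t ∈ Finset.range n, (3 : ℝ) :=
        Finset.sum_le_sum fun t _ => (le_abs_self _).trans (hω t).2
    _ = n * 3 := by simp

/-- Conditionally on the past, E[exp(X² - X)] ≤ 1 - E[X - 4X²] ≤ exp(-E[X - 4X²]), which cancels the
compensator. Here `X t` belongs to round t + 1 and is conditioned on `F t`. -/
lemma integral_exp_sum_expIncrement_le_one [IsProbabilityMeasure μ] {X : ℕ → Ω → ℝ}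
    (hX : ∀ t, StronglyMeasurable[F (t + 1)] (X t)) (hb : ∀ t, ∀ᵐ ω ∂μ, |X t ω| ≤ 1 / 2)
    (n : ℕ) :
    ∫ ω, Real.exp (∑ t ∈ Finset.range n, expIncrement μ F X t ω) ∂μ ≤ 1 := by
  induction n with
  | zero => simp
  | succ n ih =>
    refine le_trans ?_ ih
    set Y : Ω → ℝ := fun ω => X n ω - 4 * X n ω ^ 2 with hY
    set c : Ω → ℝ := μ[Y | F n] with hc
    set Z : Ω → ℝ := fun ω => Real.exp (∑ t ∈ Finset.range n, expIncrement μ F X t ω) with hZ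
    set W : Ω → ℝ := fun ω => Z ω * Real.exp (c ω) with hW
    have hXm : StronglyMeasurable (X n) := (hX n).mono (F.le _)
    have hYm : StronglyMeasurable Y := hXm.sub ((hXm.pow 2).const_mul 4)
    have hcm : StronglyMeasurable[F n] c := stronglyMeasurable_condExp
    have hZm : StronglyMeasurable[F n] Z :=
      Real.continuous_exp.comp_stronglyMeasurable (stronglyMeasurable_sum_expIncrement hX n)
    have hWm : StronglyMeasurable[F n] W := hZm.mul (Real.continuous_exp.comp_stronglyMeasurable hcm)
    have hZi : Integrable Z μ := integrable_exp_sum_expIncrement hX hb n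
    have hYb : ∀ᵐ ω ∂μ, |Y ω| ≤ 3 / 2 := by
      filter_upwards [hb n] with ω hω
      obtain ⟨h1, h2⟩ := abs_le.1 hω
      rw [abs_le]; constructor <;> simp only [hY] <;> nlinarith
    have hcb : ∀ᵐ ω ∂μ, |c ω| ≤ 3 / 2 := ae_bdd_abs_condExp_of_ae_bdd_abs hYb
    have hWi : Integrable W μ := by
      refine hZi.mul_bdd (c := Real.exp (3 / 2))
        (Real.continuous_exp.comp_stronglyMeasurable (hcm.mono (F.le n))).aestronglyMeasurable ?_
      filter_upwards [hcb] with ω hω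
      rw [Real.norm_eq_abs, Real.abs_exp]
      exact Real.exp_le_exp.2 (abs_le.1 hω).2
    have hYi : Integrable Y μ := integrable_of_abs_le hYm.aestronglyMeasurable hYb
    have hWYi : Integrable (W * Y) μ := hWi.mul_bdd hYm.aestronglyMeasurable (c := 3 / 2) hYb
    have hWci : Integrable (W * c) μ :=
      hWi.mul_bdd (hcm.mono (F.le n)).aestronglyMeasurable (c := 3 / 2) hcb
    -- `W` is known at time n, so `Y` may be replaced by its conditional expectation under the
    -- integral.
    have hpull : ∫ ω, (W * Y) ω ∂μ = ∫ ω, (W * c) ω ∂μ := by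
      rw [← integral_condExp (F.le n)]
      exact integral_congr_ae (condExp_mul_of_stronglyMeasurable_left hWm hWYi hYi)
    calc ∫ ω, Real.exp (∑ t ∈ Finset.range (n + 1), expIncrement μ F X t ω) ∂μ
        ≤ ∫ ω, (W - W * Y) ω ∂μ := by
          refine integral_mono_ae (integrable_exp_sum_expIncrement hX hb (n + 1)) (hWi.sub hWYi) ?_
          filter_upwards [hb n] with ω hω
          have h1 := exp_sq_sub_le hω
          have h2 : expIncrement μ F X n ω = c ω + (X n ω ^ 2 - X n ω) := by
            simp only [expIncrement, hc, hY]; ring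
          rw [Finset.sum_range_succ, Real.exp_add, h2, Real.exp_add, ← mul_assoc]
          have h3 : 0 < Z ω * Real.exp (c ω) := mul_pos (Real.exp_pos _) (Real.exp_pos _)
          have h4 := mul_le_mul_of_nonneg_left h1 h3.le
          simp only [Pi.sub_apply, Pi.mul_apply, hW, hY]
          calc _ ≤ _ := h4
            _ = _ := by ring
      _ = ∫ ω, (W - W * c) ω ∂μ := by
          simp only [Pi.sub_apply]
          rw [integral_sub hWi hWYi, integral_sub hWi hWci, hpull]
      _ ≤ ∫ ω, Z ω ∂μ := by
          refine integral_mono (hWi.sub hWci) hZi fun ω => ?_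
          have h1 : 1 - c ω ≤ Real.exp (-c ω) := Real.one_sub_le_exp_neg _
          have h2 : Real.exp (c ω) * Real.exp (-c ω) = 1 := by rw [← Real.exp_add]; simp
          have h3 := mul_le_mul_of_nonneg_left h1 (Real.exp_pos (c ω)).le
          have h4 : 0 < Z ω := Real.exp_pos _
          simp only [Pi.sub_apply, Pi.mul_apply, hW]
          nlinarith

lemma measure_sum_expIncrement_ge_le [IsProbabilityMeasure μ] {X : ℕ → Ω → ℝ}
    (hX : ∀ t, StronglyMeasurable[F (t + 1)] (X t)) (hb : ∀ t, ∀ᵐ ω ∂μ, |X t ω| ≤ 1 / 2)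
    (n : ℕ) (y : ℝ) :
    μ {ω | y ≤ ∑ t ∈ Finset.range n, expIncrement μ F X t ω} ≤ ENNReal.ofReal (Real.exp (-y)) := by
  have h := mul_meas_ge_le_integral_of_nonneg (μ := μ)
    (Filter.Eventually.of_forall fun ω => (Real.exp_pos _).le)
    (integrable_exp_sum_expIncrement (F := F) hX hb n) (Real.exp y)
  have h' := h.trans (integral_exp_sum_expIncrement_le_one hX hb n)
  simp only [Real.exp_le_exp] at h'
  rw [← ENNReal.ofReal_toReal (measure_ne_top μ _)]
  apply ENNReal.ofReal_le_ofReal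
  rw [Real.exp_neg, ← one_div, le_div_iff₀' (Real.exp_pos y)]
  exact h'

end Supermartingale

/-! ### Conditional expectations at random points -/

section CondExp

variable {Ω : Type*} {m m0 : MeasurableSpace Ω} {μ : @Measure Ω m0}

/-- Nonnegative conditional expectations may be evaluated at a random index. -/
lemma condExp_comp_nat_nonneg {Φ : ℕ → Ω → ℝ} (hΦ : ∀ n, Integrable (Φ n) μ)
    (h0 : ∀ n, 0 ≤ᵐ[μ] μ[Φ n | m]) {N : Ω → ℕ} (hN : Measurable[m] N)
    (hi : Integrable (fun ω => Φ (N ω) ω) μ) :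
    0 ≤ᵐ[μ] μ[fun ω => Φ (N ω) ω | m] := by
  have key : ∀ n, ∀ᵐ ω ∂μ, N ω = n → 0 ≤ (μ[fun ω => Φ (N ω) ω | m]) ω := by
    intro n
    have hA : MeasurableSet[m] (N ⁻¹' {n}) := hN (measurableSet_singleton n)
    have heq : (N ⁻¹' {n}).indicator (fun ω => Φ (N ω) ω) = (N ⁻¹' {n}).indicator (Φ n) := by
      ext ω
      by_cases h : N ω = n <;> simp [Set.indicator, h]
    have h1 := condExp_indicator (m := m) hi hA
    rw [heq] at h1
    filter_upwards [h1, condExp_indicator (m := m) (hΦ n) hA, h0 n] with ω h1 h2 h3 hω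
    rw [h2, Set.indicator_of_mem (by exact hω), Set.indicator_of_mem (by exact hω)] at h1
    rw [← h1]
    exact h3
  filter_upwards [ae_all_iff.2 key] with ω hω
  exact hω _ rfl

end CondExp

/-! ### Random losses, and weak exp-concavity at predictable random points -/

section Loss

variable {d : ℕ}

/-- A dense sequence in the `ℓ₁`-ball. -/
lemma exists_dense_seq_l1Ball (d : ℕ) : ∃ D : ℕ → (Fin d → ℝ), (∀ n, D n ∈ l1Ball d) ∧
    ∀ w ∈ l1Ball d, ∀ δ > 0, ∃ n, l1norm (w - D n) < δ := by
  have : Nonempty (l1Ball d) := ⟨⟨0, zero_mem_l1Ball⟩⟩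
  refine ⟨fun n => TopologicalSpace.denseSeq (l1Ball d) n, fun n => Subtype.coe_prop _, ?_⟩
  intro w hw δ hδ
  have hopen : IsOpen {v : l1Ball d | l1norm (w - (v : Fin d → ℝ)) < δ} :=
    isOpen_lt (continuous_l1norm.comp (continuous_const.sub continuous_subtype_val)) continuous_const
  exact (TopologicalSpace.denseRange_denseSeq (l1Ball d)).exists_mem_open hopen
    ⟨⟨w, hw⟩, by simpa [l1norm] using hδ⟩

/-- Measurable approximation by a dense sequence. -/
lemma exists_measurable_index {Ω : Type*} {m : MeasurableSpace Ω} {D : ℕ → (Fin d → ℝ)}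
    (hD : ∀ w ∈ l1Ball d, ∀ δ > 0, ∃ n, l1norm (w - D n) < δ) {w : Ω → (Fin d → ℝ)}
    (hw : Measurable w) (hwb : ∀ ω, w ω ∈ l1Ball d) {δ : ℝ} (hδ : 0 < δ) :
    ∃ N : Ω → ℕ, Measurable N ∧ ∀ ω, l1norm (w ω - D (N ω)) < δ := by
  classical
  have hex : ∀ ω, ∃ n, l1norm (w ω - D n) < δ := fun ω => hD _ (hwb ω) δ hδ
  refine ⟨fun ω => Nat.find (hex ω), measurable_find hex fun n => ?_, fun ω => Nat.find_spec (hex ω)⟩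
  exact measurableSet_lt (continuous_l1norm.measurable.comp (hw.sub_const _)) measurable_const

variable {Ω : Type*} {m : MeasurableSpace Ω} {μ : Measure Ω} {F : Filtration ℕ m}
  {ℓ : ℕ → Ω → (Fin d → ℝ) → ℝ} {g : ℕ → Ω → (Fin d → ℝ) → (Fin d → ℝ)} {G : ℝ}

lemma IsRandomConvexLoss.measurable_grad_comp (h : IsRandomConvexLoss μ F ℓ g) {t : ℕ} (ht : 1 ≤ t)
    {p : Ω → (Fin d → ℝ)} (hp : Measurable[F t] p) : Measurable[F t] fun ω => g t ω (p ω) :=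
  (h.measurable_grad t ht).comp (measurable_id.prodMk hp)

/-- Finite convex functions on ℝ^d are continuous, so measurability at each fixed point already
gives joint measurability. Subgradients lack this continuity, and their joint measurability is part
of the hypotheses. -/
lemma IsRandomConvexLoss.measurable_loss_comp (h : IsRandomConvexLoss μ F ℓ g) {t : ℕ} (ht : 1 ≤ t)
    {p : Ω → (Fin d → ℝ)} (hp : Measurable[F t] p) : Measurable[F t] fun ω => ℓ t ω (p ω) := by
  have h1 : Measurable[MeasurableSpace.pi.prod (F t)] (Function.uncurry fun θ ω => ℓ t ω θ) :=
    measurable_uncurry_of_continuous_of_measurable (m := F t)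
      (fun ω => (h.convex t ht ω).locallyLipschitz.continuous) (h.measurable_loss t ht)
  exact h1.comp (hp.prodMk measurable_id)

lemma IsRandomConvexLoss.sub_le (h : IsRandomConvexLoss μ F ℓ g) {t : ℕ} (ht : 1 ≤ t) {ω : Ω}
    (hG : ∀ θ ∈ l1Ball d, ∀ i, |g t ω θ i| ≤ G) {θ : Fin d → ℝ} (hθ : θ ∈ l1Ball d)
    (θ' : Fin d → ℝ) : ℓ t ω θ - ℓ t ω θ' ≤ G * l1norm (θ - θ') := by
  have h1 := h.subgradient t ht ω θ θ'
  have h2 := (abs_le.1 (abs_dotProduct_le (hG θ hθ) (θ - θ'))).2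
  have h3 : g t ω θ ⬝ᵥ (θ - θ') = - (g t ω θ ⬝ᵥ (θ' - θ)) := by
    rw [← dotProduct_neg, neg_sub]
  linarith

lemma IsRandomConvexLoss.abs_sub_le (h : IsRandomConvexLoss μ F ℓ g) {t : ℕ} (ht : 1 ≤ t) {ω : Ω}
    (hG : ∀ θ ∈ l1Ball d, ∀ i, |g t ω θ i| ≤ G) {θ θ' : Fin d → ℝ} (hθ : θ ∈ l1Ball d)
    (hθ' : θ' ∈ l1Ball d) : |ℓ t ω θ - ℓ t ω θ'| ≤ G * l1norm (θ - θ') := by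
  rw [abs_le]
  have h1 := h.sub_le ht hG hθ θ'
  have h2 := h.sub_le ht hG hθ' θ
  have h3 : l1norm (θ' - θ) = l1norm (θ - θ') := by rw [← l1norm_neg, neg_sub]
  rw [h3] at h2
  constructor <;> linarith

lemma IsRandomConvexLoss.integrable_comp [IsFiniteMeasure μ] (h : IsRandomConvexLoss μ F ℓ g)
    (hG : LipschitzLoss μ g G) (hG0 : 0 ≤ G) {t : ℕ} (ht : 1 ≤ t) {p : Ω → (Fin d → ℝ)}
    (hp : Measurable[F t] p) (hpb : ∀ ω, p ω ∈ l1Ball d) :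
    Integrable (fun ω => ℓ t ω (p ω)) μ := by
  have h0 := h.integrable t ht 0 zero_mem_l1Ball
  have hm : Measurable fun ω => ℓ t ω (p ω) := (h.measurable_loss_comp ht hp).mono (F.le t) le_rfl
  have h1 : Integrable (fun ω => ℓ t ω (p ω) - ℓ t ω 0) μ := by
    refine integrable_of_abs_le (hm.aestronglyMeasurable.sub h0.aestronglyMeasurable) (C := G * 2) ?_
    filter_upwards [hG] with ω hω
    exact (h.abs_sub_le ht (hω t ht) (hpb ω) zero_mem_l1Ball).trans
      (mul_le_mul_of_nonneg_left (l1norm_sub_le_two (hpb ω) zero_mem_l1Ball) hG0)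
  exact (h1.add h0).congr (Filter.Eventually.of_forall fun ω => by simp)

/-- The instantaneous linearised regret of the point `p` with respect to `θ`. -/
def linRegret (g : ℕ → Ω → (Fin d → ℝ) → (Fin d → ℝ)) (t : ℕ) (p : Ω → (Fin d → ℝ))
    (θ : Fin d → ℝ) (ω : Ω) : ℝ := g t ω (p ω) ⬝ᵥ (p ω - θ)

lemma IsRandomConvexLoss.measurable_linRegret (h : IsRandomConvexLoss μ F ℓ g) {t : ℕ} (ht : 1 ≤ t)
    {p : Ω → (Fin d → ℝ)} (hp : Measurable[F t] p) (θ : Fin d → ℝ) :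
    Measurable[F t] (linRegret g t p θ) := by
  have h1 := h.measurable_grad_comp ht hp
  unfold linRegret dotProduct
  refine Finset.measurable_sum _ fun i _ => ?_
  exact ((measurable_pi_apply i).comp h1).mul
    (((measurable_pi_apply i).comp hp).sub_const (θ i))

lemma LipschitzLoss.abs_linRegret_le (hG : LipschitzLoss μ g G) (hG0 : 0 ≤ G) {p : Ω → (Fin d → ℝ)}
    (hpb : ∀ ω, p ω ∈ l1Ball d) {θ : Fin d → ℝ} (hθ : θ ∈ l1Ball d) {t : ℕ} (ht : 1 ≤ t) :
    ∀ᵐ ω ∂μ, |linRegret g t p θ ω| ≤ 2 * G := by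
  filter_upwards [hG] with ω hω
  refine (abs_dotProduct_le (hω t ht _ (hpb ω)) _).trans ?_
  have := mul_le_mul_of_nonneg_left (l1norm_sub_le_two (hpb ω) hθ) hG0
  linarith

lemma integrable_sub_mul_sq [IsFiniteMeasure μ] {f : Ω → ℝ} (hf : Measurable f) {M : ℝ}
    (hb : ∀ᵐ ω ∂μ, |f ω| ≤ M) (c : ℝ) : Integrable (fun ω => f ω - c * f ω ^ 2) μ := by
  have h1 : Integrable f μ := integrable_of_abs_le hf.aestronglyMeasurable hb
  have h2 : Integrable (fun ω => f ω ^ 2) μ := by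
    refine integrable_of_abs_le (hf.pow_const 2).aestronglyMeasurable (C := M ^ 2) ?_
    filter_upwards [hb] with ω hω
    rw [abs_pow]
    exact pow_le_pow_left₀ (abs_nonneg _) hω 2
  exact h1.sub (h2.const_mul c)

/-- Weak exp-concavity, linearised, at fixed points. -/
lemma WeakExpConcave.condExp_linearized_nonneg [IsFiniteMeasure μ] (h : IsRandomConvexLoss μ F ℓ g)
    (hG : LipschitzLoss μ g G) (hG0 : 0 ≤ G) {α β ρ η : ℝ} (hα : 0 < α) (hβ0 : 0 ≤ β) (hβ1 : β ≤ 1)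
    (hw : WeakExpConcave μ F ℓ g α β) (hρ : 0 < ρ) (hη : 4 * η ≤ α * ρ ^ (1 - β))
    {t : ℕ} (ht : 1 ≤ t) {θ₁ θ₂ : Fin d → ℝ} (h₁ : θ₁ ∈ l1Ball d) (h₂ : θ₂ ∈ l1Ball d) :
    0 ≤ᵐ[μ] μ[fun ω => (linRegret g t (fun _ => θ₁) θ₂ ω -
      4 * η * linRegret g t (fun _ => θ₁) θ₂ ω ^ 2) + ρ - (ℓ t ω θ₁ - ℓ t ω θ₂) | F (t - 1)] := by
  obtain ⟨hw0, hw1⟩ := hw t ht θ₁ h₁ θ₂ h₂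
  set u := linRegret g t (fun _ => θ₁) θ₂ with hu
  have hum : Measurable u := (h.measurable_linRegret ht measurable_const θ₂).mono (F.le t) le_rfl
  have hub : ∀ᵐ ω ∂μ, |u ω| ≤ 2 * G := hG.abs_linRegret_le hG0 (fun _ => h₁) h₂ ht
  have hui : Integrable u μ := integrable_of_abs_le hum.aestronglyMeasurable hub
  have hψm : Measurable fun ω => powInv (α * u ω ^ 2) β := by
    unfold powInv
    split_ifs
    · exact measurable_const
    · exact ((hum.pow_const 2).const_mul α).pow_const _
  have hψi : Integrable (fun ω => powInv (α * u ω ^ 2) β) μ := by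
    refine integrable_of_abs_le hψm.aestronglyMeasurable (C := (α * (2 * G) ^ 2) ^ (1 / β)) ?_
    filter_upwards [hub] with ω hω
    unfold powInv
    split_ifs with hb
    · rw [abs_zero]; positivity
    · rw [abs_of_nonneg (by positivity)]
      have : u ω ^ 2 ≤ (2 * G) ^ 2 := by
        rw [← sq_abs]; exact pow_le_pow_left₀ (abs_nonneg _) hω 2
      gcongr
  have hℓi : Integrable (fun ω => ℓ t ω θ₁ - ℓ t ω θ₂) μ :=
    (h.integrable t ht θ₁ h₁).sub (h.integrable t ht θ₂ h₂)
  have hle : (fun ω => u ω - powInv (α * u ω ^ 2) β - (ℓ t ω θ₁ - ℓ t ω θ₂)) ≤ᵐ[μ]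
      fun ω => (u ω - 4 * η * u ω ^ 2) + ρ - (ℓ t ω θ₁ - ℓ t ω θ₂) := by
    have hae : ∀ᵐ ω ∂μ, β = 0 → α * u ω ^ 2 ≤ 1 := by
      by_cases hb : β = 0
      · filter_upwards [hw0 hb] with ω hω _
        exact hω
      · exact Filter.Eventually.of_forall fun _ h => absurd h hb
    filter_upwards [hae] with ω hω
    have := mul_le_powInv_add hα hβ0 hβ1 hρ (sq_nonneg (u ω)) hω
    have := mul_le_mul_of_nonneg_right hη (sq_nonneg (u ω))
    linarith
  have hmono := condExp_mono (m := F (t - 1)) ((hui.sub hψi).sub hℓi)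
    (((integrable_sub_mul_sq hum hub (4 * η)).add (integrable_const ρ)).sub hℓi) hle
  filter_upwards [hmono, condExp_sub (hui.sub hψi) hℓi (F (t - 1)),
    condExp_sub hui hψi (F (t - 1)), hw1] with ω e1 e2 e3 e4
  refine le_trans ?_ e1
  change (0 : ℝ) ≤ (μ[(u - fun ω => powInv (α * u ω ^ 2) β) - (fun ω => ℓ t ω θ₁ - ℓ t ω θ₂) | F (t - 1)]) ω
  rw [e2, Pi.sub_apply, e3, Pi.sub_apply]
  have e5 : (μ[fun ω => ℓ t ω θ₁ - ℓ t ω θ₂ | F (t - 1)]) ω ≤ (μ[u | F (t - 1)]) ω -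
      (μ[fun ω => powInv (α * u ω ^ 2) β | F (t - 1)]) ω := e4
  linarith

/-- The subgradient at `p` dominates, up to a small error, the one at a point `z` close to
`p - ε (p - θ)`. -/
lemma IsRandomConvexLoss.surrogate_le (h : IsRandomConvexLoss μ F ℓ g) (hG0 : 0 ≤ G) {t : ℕ}
    (ht : 1 ≤ t) {ω : Ω} (hG : ∀ θ ∈ l1Ball d, ∀ i, |g t ω θ i| ≤ G) {p z θ : Fin d → ℝ}
    (hp : p ∈ l1Ball d) (hz : z ∈ l1Ball d) (hθ : θ ∈ l1Ball d) {ε η ρ : ℝ} (hε0 : 0 < ε)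
    (hε1 : ε ≤ 1) (hη0 : 0 ≤ η) (hη : 8 * G * η ≤ 1)
    (hclose : l1norm ((1 - ε) • p + ε • θ - z) ≤ ε ^ 2) :
    (g t ω z ⬝ᵥ (z - θ) - 4 * η * (g t ω z ⬝ᵥ (z - θ)) ^ 2) + ρ - (ℓ t ω z - ℓ t ω θ) ≤
      (g t ω p ⬝ᵥ (p - θ) - η * (g t ω p ⬝ᵥ (p - θ)) ^ 2) + ρ - (ℓ t ω p - ℓ t ω θ) + 13 * G * ε := by
  set v := (1 - ε) • p + ε • θ - z with hv
  have hpz : p - z = ε • (p - θ) + v := by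
    rw [hv]; module
  have hzp : z - p = -(ε • (p - θ) + v) := by rw [← hpz, neg_sub]
  have hzθ : z - θ = (p - θ) - ε • (p - θ) - v := by
    rw [hv]; module
  have hpθ := l1norm_sub_le_two hp hθ
  have hbound : ∀ θ' ∈ l1Ball d, |g t ω θ' ⬝ᵥ (p - θ)| ≤ 2 * G := fun θ' hθ' =>
    (abs_dotProduct_le (hG θ' hθ') _).trans (by nlinarith)
  have hv' : ∀ θ' ∈ l1Ball d, |g t ω θ' ⬝ᵥ v| ≤ G * ε ^ 2 := fun θ' hθ' =>
    (abs_dotProduct_le (hG θ' hθ') _).trans (mul_le_mul_of_nonneg_left hclose hG0)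
  have hε2 : ε ^ 2 ≤ ε := by nlinarith
  have hGε : G * ε ^ 2 ≤ G * ε := mul_le_mul_of_nonneg_left hε2 hG0
  -- Adding the subgradient inequalities at p and z gives monotonicity along p - z, which is ε(p -
  -- θ) up to an error of size ε². Division by ε leaves an error of order Gε.
  have hmon : g t ω z ⬝ᵥ (p - θ) ≤ g t ω p ⬝ᵥ (p - θ) + 2 * (G * ε) := by
    have e1 := h.subgradient t ht ω p z
    have e2 := h.subgradient t ht ω z p
    rw [hzp, dotProduct_neg, dotProduct_add, dotProduct_smul, smul_eq_mul] at e1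
    rw [hpz, dotProduct_add, dotProduct_smul, smul_eq_mul] at e2
    have e3 := (abs_le.1 (hv' p hp)).2
    have e4 := (abs_le.1 (hv' z hz)).1
    have e5 : ε * (g t ω z ⬝ᵥ (p - θ)) ≤ ε * (g t ω p ⬝ᵥ (p - θ) + 2 * (G * ε)) := by
      linarith
    exact le_of_mul_le_mul_left e5 hε0
  have hu : g t ω z ⬝ᵥ (z - θ) ≤ g t ω p ⬝ᵥ (p - θ) + 5 * (G * ε) := by
    have e1 := (abs_le.1 (hv' z hz)).1
    have e2 := mul_le_mul_of_nonneg_left (abs_le.1 (hbound z hz)).1 hε0.le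
    rw [hzθ, dotProduct_sub, dotProduct_sub, dotProduct_smul, smul_eq_mul]
    linarith
  have hub : |g t ω z ⬝ᵥ (z - θ)| ≤ 2 * G :=
    (abs_dotProduct_le (hG z hz) _).trans (by nlinarith [l1norm_sub_le_two hz hθ])
  have hmain := sub_sq_le_of_le_add hub (hbound p hp) (by positivity) hη0 (by linarith) hu
  have hloss : ℓ t ω p - ℓ t ω z ≤ 3 * (G * ε) := by
    refine (h.sub_le ht hG hp z).trans ?_
    have : l1norm (p - z) ≤ 3 * ε := by
      rw [hpz]
      refine (l1norm_add_le _ _).trans ?_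
      rw [l1norm_smul, abs_of_pos hε0]
      nlinarith
    nlinarith
  linarith

/-- Weak exp-concavity, linearised, at a random point known before the round. -/
lemma WeakExpConcave.condExp_linearized_comp_nonneg [IsProbabilityMeasure μ]
    (h : IsRandomConvexLoss μ F ℓ g) (hG : LipschitzLoss μ g G) (hG0 : 0 ≤ G) {α β ρ η : ℝ}
    (hα : 0 < α) (hβ0 : 0 ≤ β) (hβ1 : β ≤ 1) (hw : WeakExpConcave μ F ℓ g α β) (hρ : 0 < ρ)
    (hη0 : 0 ≤ η) (hη : 4 * η ≤ α * ρ ^ (1 - β)) (hηG : 8 * G * η ≤ 1) {t : ℕ} (ht : 1 ≤ t)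
    {p : Ω → (Fin d → ℝ)} (hp : Measurable[F (t - 1)] p) (hpb : ∀ ω, p ω ∈ l1Ball d)
    {θ : Fin d → ℝ} (hθ : θ ∈ l1Ball d) :
    0 ≤ᵐ[μ] μ[fun ω => (linRegret g t p θ ω - η * linRegret g t p θ ω ^ 2) + ρ -
      (ℓ t ω (p ω) - ℓ t ω θ) | F (t - 1)] := by
  obtain ⟨D, hDb, hD⟩ := exists_dense_seq_l1Ball d
  have hmono : F (t - 1) ≤ F t := F.mono (Nat.sub_le t 1)
  have hpt : Measurable[F t] p := hp.mono hmono le_rfl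
  have hint : ∀ (z : Ω → (Fin d → ℝ)) (c : ℝ), Measurable[F t] z → (∀ ω, z ω ∈ l1Ball d) →
      Integrable (fun ω => (linRegret g t z θ ω - c * linRegret g t z θ ω ^ 2) + ρ -
        (ℓ t ω (z ω) - ℓ t ω θ)) μ := fun z c hz hzb =>
    ((integrable_sub_mul_sq ((h.measurable_linRegret ht hz θ).mono (F.le t) le_rfl)
      (hG.abs_linRegret_le hG0 hzb hθ ht) c).add (integrable_const ρ)).sub
      ((h.integrable_comp hG hG0 ht hz hzb).sub (h.integrable t ht θ hθ))
  have key : ∀ n : ℕ, ∀ᵐ ω ∂μ, 0 ≤ (μ[fun ω => (linRegret g t p θ ω - η * linRegret g t p θ ω ^ 2) +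
      ρ - (ℓ t ω (p ω) - ℓ t ω θ) | F (t - 1)]) ω + 13 * G * (1 / ((n : ℝ) + 1)) := by
    intro n
    set ε : ℝ := 1 / ((n : ℝ) + 1) with hε
    have hε0 : 0 < ε := by positivity
    have hε1 : ε ≤ 1 := by
      rw [hε, div_le_one (by positivity)]
      linarith [Nat.cast_nonneg (α := ℝ) n]
    have hwm : Measurable[F (t - 1)] fun ω => (1 - ε) • p ω + ε • θ :=
      (hp.const_smul (1 - ε)).add_const _
    have hwb : ∀ ω, (1 - ε) • p ω + ε • θ ∈ l1Ball d := fun ω =>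
      convex_l1Ball (hpb ω) hθ (by linarith) hε0.le (by ring)
    -- The random point is replaced by one with countably many values, where the fixed-point
    -- hypothesis applies. The tolerance must be ε², since the error is later divided by ε.
    obtain ⟨N, hN, hNc⟩ := exists_measurable_index (m := F (t - 1)) hD hwm hwb
      (show 0 < ε ^ 2 by positivity)
    have hzm : Measurable[F t] fun ω => D (N ω) :=
      (Measurable.of_discrete (f := D)).comp (hN.mono hmono le_rfl)
    have hzi := hint (fun ω => D (N ω)) (4 * η) hzm (fun ω => hDb _)
    have h1 := condExp_comp_nat_nonneg (m := F (t - 1)) (N := N)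
      (Φ := fun k ω => (linRegret g t (fun _ => D k) θ ω -
        4 * η * linRegret g t (fun _ => D k) θ ω ^ 2) + ρ - (ℓ t ω (D k) - ℓ t ω θ))
      (fun k => hint (fun _ => D k) (4 * η) measurable_const (fun _ => hDb k))
      (fun k => hw.condExp_linearized_nonneg h hG hG0 hα hβ0 hβ1 hρ hη ht (hDb k) hθ) hN hzi
    have hpi := hint p η hpt hpb
    have h2 := condExp_mono (m := F (t - 1)) hzi (hpi.add (integrable_const (13 * G * ε))) (by
      filter_upwards [hG] with ω hω
      exact h.surrogate_le hG0 ht (hω t ht) (hpb ω) (hDb _) hθ hε0 hε1 hη0 hηG (hNc ω).le)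
    filter_upwards [h1, h2, condExp_add hpi (integrable_const (13 * G * ε)) (F (t - 1))]
      with ω e1 e2 e3
    have e4 := e1.trans e2
    rw [e3, Pi.add_apply, condExp_const (F.le _)] at e4
    exact e4
  filter_upwards [ae_all_iff.2 key] with ω hω
  have hlim : Filter.Tendsto (fun n : ℕ => (μ[fun ω => (linRegret g t p θ ω -
      η * linRegret g t p θ ω ^ 2) + ρ - (ℓ t ω (p ω) - ℓ t ω θ) | F (t - 1)]) ω +
      13 * G * (1 / ((n : ℝ) + 1))) Filter.atTop
      (nhds ((μ[fun ω => (linRegret g t p θ ω - η * linRegret g t p θ ω ^ 2) + ρ -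
        (ℓ t ω (p ω) - ℓ t ω θ) | F (t - 1)]) ω + 13 * G * 0)) :=
    tendsto_const_nhds.add (tendsto_one_div_add_atTop_nhds_zero_nat.const_mul _)
  rw [mul_zero, add_zero] at hlim
  exact ge_of_tendsto' hlim hω

/-- Conditional regret with respect to a point whose surrogate losses are dominated by those of
grid points. -/
lemma condExp_loss_sub_le [IsProbabilityMeasure μ]
    (h : IsRandomConvexLoss μ F ℓ g) (hG : LipschitzLoss μ g G) (hG0 : 0 ≤ G) {α β ρ η : ℝ}
    (hα : 0 < α) (hβ0 : 0 ≤ β) (hβ1 : β ≤ 1) (hw : WeakExpConcave μ F ℓ g α β) (hρ : 0 < ρ)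
    (hη0 : 0 ≤ η) (hη : 4 * η ≤ α * ρ ^ (1 - β)) (hηG : 8 * G * η ≤ 1) {t : ℕ} (ht : 1 ≤ t)
    {p : Ω → (Fin d → ℝ)} (hp : Measurable[F (t - 1)] p) (hpb : ∀ ω, p ω ∈ l1Ball d)
    {θ : Fin d → ℝ} (hθ : θ ∈ l1Ball d) {grid : Finset (Fin d → ℝ)}
    (hgrid : ∀ θ ∈ grid, θ ∈ l1Ball d) (v₁ v₂ : (Fin d → ℝ) → ℝ) (c₁ c₂ c : ℝ)
    (hdom : ∀ h p : Fin d → ℝ, (∀ i, |h i| ≤ G) → p ∈ l1Ball d →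
      h ⬝ᵥ (p - θ) - η * (h ⬝ᵥ (p - θ)) ^ 2 ≤
        ∑ j ∈ grid, (v₁ j * (h ⬝ᵥ (p - j) - c₁ * (h ⬝ᵥ (p - j)) ^ 2) +
          v₂ j * (h ⬝ᵥ (p - j) - c₂ * (h ⬝ᵥ (p - j)) ^ 2)) + c) :
    ∀ᵐ ω ∂μ, (μ[fun ω => ℓ t ω (p ω) | F (t - 1)]) ω - (μ[fun ω => ℓ t ω θ | F (t - 1)]) ω ≤
      ∑ j ∈ grid,
        (v₁ j * (μ[fun ω => linRegret g t p j ω - c₁ * linRegret g t p j ω ^ 2 | F (t - 1)]) ω +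
          v₂ j * (μ[fun ω => linRegret g t p j ω - c₂ * linRegret g t p j ω ^ 2 | F (t - 1)]) ω) +
      c + ρ := by
  have hpt : Measurable[F t] p := hp.mono (F.mono (Nat.sub_le t 1)) le_rfl
  have hYi : ∀ j ∈ l1Ball d, ∀ c, Integrable (fun ω => linRegret g t p j ω - c * linRegret g t p j ω ^ 2) μ :=
    fun j hj c => integrable_sub_mul_sq ((h.measurable_linRegret ht hpt j).mono (F.le t) le_rfl)
      (hG.abs_linRegret_le hG0 hpb hj ht) c
  have hℓp := h.integrable_comp hG hG0 ht hpt hpb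
  have hℓθ := h.integrable t ht θ hθ
  have hi1 := ((hYi θ hθ η).add (integrable_const ρ)).sub (hℓp.sub hℓθ)
  have hS : ∀ j ∈ grid, Integrable
      (v₁ j • (fun ω => linRegret g t p j ω - c₁ * linRegret g t p j ω ^ 2) +
        v₂ j • (fun ω => linRegret g t p j ω - c₂ * linRegret g t p j ω ^ 2)) μ := fun j hj =>
    ((hYi j (hgrid j hj) c₁).smul (v₁ j)).add ((hYi j (hgrid j hj) c₂).smul (v₂ j))
  have hSi := integrable_finsetSum' grid hS
  have hci : Integrable (fun _ : Ω => c + ρ) μ := integrable_const _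
  have h1 := condExp_mono (m := F (t - 1)) hi1 ((hSi.add hci).sub (hℓp.sub hℓθ)) (by
    filter_upwards [hG] with ω hω
    have := hdom (g t ω (p ω)) (p ω) (hω t ht _ (hpb ω)) (hpb ω)
    simp only [Pi.sub_apply, Pi.add_apply, Finset.sum_apply, Pi.smul_apply, smul_eq_mul, linRegret]
    linarith)
  have hparts : ∀ᵐ ω ∂μ, ∀ j ∈ grid,
      (μ[v₁ j • (fun ω => linRegret g t p j ω - c₁ * linRegret g t p j ω ^ 2) +
        v₂ j • (fun ω => linRegret g t p j ω - c₂ * linRegret g t p j ω ^ 2) | F (t - 1)]) ω =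
      v₁ j * (μ[fun ω => linRegret g t p j ω - c₁ * linRegret g t p j ω ^ 2 | F (t - 1)]) ω +
          v₂ j * (μ[fun ω => linRegret g t p j ω - c₂ * linRegret g t p j ω ^ 2 | F (t - 1)]) ω := by
    rw [Finset.eventually_all]
    intro j hj
    filter_upwards [condExp_add ((hYi j (hgrid j hj) c₁).smul (v₁ j))
      ((hYi j (hgrid j hj) c₂).smul (v₂ j)) (F (t - 1)),
      condExp_smul (μ := μ) (v₁ j) (fun ω => linRegret g t p j ω - c₁ * linRegret g t p j ω ^ 2) (F (t - 1)),
      condExp_smul (μ := μ) (v₂ j) (fun ω => linRegret g t p j ω - c₂ * linRegret g t p j ω ^ 2) (F (t - 1))]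
      with ω e1 e2 e3
    rw [e1, Pi.add_apply, e2, e3]
    rfl
  filter_upwards [h1, hw.condExp_linearized_comp_nonneg h hG hG0 hα hβ0 hβ1 hρ hη0 hη hηG ht hp hpb hθ,
    condExp_sub (hSi.add hci) (hℓp.sub hℓθ) (F (t - 1)), condExp_add hSi hci (F (t - 1)),
    condExp_sub hℓp hℓθ (F (t - 1)), condExp_finsetSum hS (F (t - 1)), hparts]
    with ω e1 e2 e3 e4 e5 e6 e7
  have e8 := e2.trans e1
  rw [e3, Pi.sub_apply, e4, Pi.add_apply, e5, Pi.sub_apply, e6, Finset.sum_apply,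
    condExp_const (F.le _), Finset.sum_congr rfl e7] at e8
  simp only [Pi.zero_apply] at e8
  linarith

/-- Continuous versions of the conditional risks exist. -/
lemma exists_isCondRisk [IsProbabilityMeasure μ] (h : IsRandomConvexLoss μ F ℓ g)
    (hG : LipschitzLoss μ g G) (hG0 : 0 ≤ G) :
    ∃ L : ℕ → (Fin d → ℝ) → Ω → ℝ, IsCondRisk μ F ℓ L := by
  obtain ⟨D, hDb, hD⟩ := exists_dense_seq_l1Ball d
  let Y : ℕ → (Fin d → ℝ) → Ω → ℝ := fun t θ => μ[fun ω => ℓ t ω θ | F (t - 1)]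
  -- The factor d compares the ℓ₁-norm with the sup-distance of `Fin d → ℝ`. Almost surely the
  -- conditional risks are `K`-Lipschitz on a countable dense set, and extending them from it gives
  -- the version.
  let K : NNReal := ⟨G * d, by positivity⟩
  have hK : ∀ θ θ' : Fin d → ℝ, G * l1norm (θ - θ') ≤ K * dist θ θ' := by
    intro θ θ'
    rw [dist_eq_norm]
    have := mul_le_mul_of_nonneg_left (l1norm_le_mul_norm (θ - θ')) hG0
    change _ ≤ G * d * _
    linarith
  have hpair : ∀ t, 1 ≤ t → ∀ θ ∈ l1Ball d, ∀ θ' ∈ l1Ball d,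
      ∀ᵐ ω ∂μ, |Y t θ ω - Y t θ' ω| ≤ G * l1norm (θ - θ') := by
    intro t ht θ hθ θ' hθ'
    have h1 : ∀ᵐ ω ∂μ, |((fun ω => ℓ t ω θ) - fun ω => ℓ t ω θ') ω| ≤ G * l1norm (θ - θ') := by
      filter_upwards [hG] with ω hω
      exact h.abs_sub_le ht (hω t ht) hθ hθ'
    filter_upwards [ae_bdd_abs_condExp_of_ae_bdd_abs (m := F (t - 1)) h1,
      condExp_sub (h.integrable t ht θ hθ) (h.integrable t ht θ' hθ') (F (t - 1))] with ω e1 e2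
    rwa [e2] at e1
  have hlip : ∀ t, 1 ≤ t → ∀ᵐ ω ∂μ, LipschitzOnWith K (fun θ => Y t θ ω) (Set.range D) := by
    intro t ht
    filter_upwards [ae_all_iff.2 fun n => ae_all_iff.2 fun k =>
      hpair t ht (D n) (hDb n) (D k) (hDb k)] with ω hω
    apply LipschitzOnWith.of_dist_le_mul
    rintro _ ⟨n, rfl⟩ _ ⟨k, rfl⟩
    rw [Real.dist_eq]
    exact (hω n k).trans (hK _ _)
  have hext : ∀ (t : ℕ) (ω : Ω), ∃ f : (Fin d → ℝ) → ℝ,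
      LipschitzOnWith K (fun θ => Y t θ ω) (Set.range D) →
        LipschitzWith K f ∧ Set.EqOn (fun θ => Y t θ ω) f (Set.range D) := by
    intro t ω
    by_cases hω : LipschitzOnWith K (fun θ => Y t θ ω) (Set.range D)
    · obtain ⟨f, hf⟩ := hω.extend_real
      exact ⟨f, fun _ => hf⟩
    · exact ⟨0, fun h => absurd h hω⟩
  choose f hf using hext
  refine ⟨fun t θ ω => f t ω θ, ?_, ?_⟩
  · intro t ht θ hθ
    filter_upwards [hlip t ht, ae_all_iff.2 fun n => hpair t ht θ hθ (D n) (hDb n)] with ω e1 e2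
    obtain ⟨hfl, hfe⟩ := hf t ω e1
    change f t ω θ = Y t θ ω
    rw [← sub_eq_zero, ← abs_eq_zero]
    -- For one fixed θ, the pairs (θ, `D n`) form a countable family, so the extension and the
    -- conditional expectation at θ are both close to the value at a nearby dense point.
    refine le_antisymm (le_of_forall_pos_le_add fun δ hδ => ?_) (abs_nonneg _)
    have hdense : ∃ n, K * dist θ (D n) + G * l1norm (θ - D n) < δ := by
      obtain ⟨n, hn⟩ := hD θ hθ (δ / (2 * (G * d) + 2 * G + 1)) (by positivity)
      refine ⟨n, ?_⟩
      have h1 : dist θ (D n) ≤ l1norm (θ - D n) := by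
        rw [dist_eq_norm, pi_norm_le_iff_of_nonneg (l1norm_nonneg _)]
        intro i
        exact Finset.single_le_sum (f := fun i => |(θ - D n) i|) (fun _ _ => abs_nonneg _)
          (Finset.mem_univ i)
      rw [lt_div_iff₀ (by positivity)] at hn
      have h2 : G * d * dist θ (D n) ≤ G * d * l1norm (θ - D n) :=
        mul_le_mul_of_nonneg_left h1 (by positivity)
      have h3 := l1norm_nonneg (θ - D n)
      have h4 : 0 ≤ G * d * l1norm (θ - D n) := by positivity
      have h5 : 0 ≤ G * l1norm (θ - D n) := by positivity
      change G * d * _ + _ < _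
      nlinarith
    obtain ⟨n, hn⟩ := hdense
    have h1 : |f t ω θ - f t ω (D n)| ≤ K * dist θ (D n) := by
      rw [← Real.dist_eq]; exact hfl.dist_le_mul _ _
    have h2 := e2 n
    have h3 : f t ω (D n) = Y t (D n) ω := (hfe ⟨n, rfl⟩).symm
    rw [h3] at h1
    have h4 : f t ω θ - Y t θ ω = (f t ω θ - Y t (D n) ω) - (Y t θ ω - Y t (D n) ω) := by ring
    rw [h4]
    exact (abs_sub _ _).trans (by linarith)
  · filter_upwards [ae_all_iff.2 fun t => ae_all_iff.2 fun ht : 1 ≤ t => hlip t ht] with ω hω t ht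
    exact (hf t ω (hω t ht)).1.continuous.continuousOn

end Loss

/-! ### The event on which the algorithm has small conditional regret -/

section Event

variable {d : ℕ} {Ω : Type*} {m : MeasurableSpace Ω} {μ : Measure Ω} {F : Filtration ℕ m}
  {ℓ : ℕ → Ω → (Fin d → ℝ) → ℝ} {g : ℕ → Ω → (Fin d → ℝ) → (Fin d → ℝ)} {G : ℝ}

lemma measurable_predict {m' : MeasurableSpace Ω} {E : ℝ} {T : ℕ} {grid : Finset (Fin d → ℝ)}
    {prior : (Fin d → ℝ) → ℝ} {S : Ω → (Fin d → ℝ) → ℕ → ℝ}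
    (hS : ∀ θ i, Measurable fun ω => S ω θ i) :
    Measurable fun ω => predict E T grid prior (S ω) := by
  have hraw : ∀ θ, Measurable fun ω => rawWeight E T prior (S ω) θ := fun θ =>
    Finset.measurable_sum _ fun i _ =>
      (((hS θ i).const_mul (rate E i)).exp.const_mul (rate E i)).mul_const _
  exact Finset.measurable_sum _ fun θ _ =>
    ((hraw θ).div (Finset.measurable_sum _ fun θ' _ => hraw θ')).smul_const θ

lemma IsRandomConvexLoss.measurable_squintState (h : IsRandomConvexLoss μ F ℓ g) (E : ℝ) (T : ℕ)
    (grid : Finset (Fin d → ℝ)) (prior : (Fin d → ℝ) → ℝ) (t : ℕ) :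
    ∀ θ i, Measurable[F t] fun ω => squintState E T grid prior (fun s => g s ω) t θ i := by
  induction t with
  | zero => intro θ i; exact measurable_const
  | succ t ih =>
    intro θ i
    have hS : ∀ θ i, Measurable[F (t + 1)] fun ω =>
        squintState E T grid prior (fun s => g s ω) t θ i := fun θ i =>
      (ih θ i).mono (F.mono t.le_succ) le_rfl
    have hp := measurable_predict (m' := F (t + 1)) (E := E) (T := T) (grid := grid)
      (prior := prior) hS
    have hr := h.measurable_linRegret (Nat.le_add_left 1 t) hp θ
    exact (hS θ i).add (hr.sub ((hr.pow_const 2).const_mul (rate E i)))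

lemma IsRandomConvexLoss.measurable_squint (h : IsRandomConvexLoss μ F ℓ g) (E : ℝ) (T : ℕ)
    (grid : Finset (Fin d → ℝ)) (prior : (Fin d → ℝ) → ℝ) (t : ℕ) :
    Measurable[F t] fun ω => squint E T grid prior (fun s => g s ω) t :=
  measurable_predict (m' := F t) (h.measurable_squintState E T grid prior t)

/-- Outside an event of probability `e^{-x}`, the conditional second-order regret with respect to
all grid points and for all learning rates is small. -/
lemma exists_regret_event [IsProbabilityMeasure μ] (h : IsRandomConvexLoss μ F ℓ g)
    (hG : LipschitzLoss μ g G) (hG0 : 0 < G) {T : ℕ} {grid : Finset (Fin d → ℝ)}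
    (hN : 1 ≤ numRates (8 * G / 3) T) (hne : grid.Nonempty)
    (hgrid : ∀ θ ∈ grid, θ ∈ l1Ball d) (x : ℝ) {p : ℕ → Ω → (Fin d → ℝ)}
    (hp : p = fun t ω => squint (8 * G / 3) T grid (uniformPrior grid) (fun s => g s ω) t) :
    ∃ B : Set Ω, μ B ≤ ENNReal.ofReal (Real.exp (-x)) ∧ ∀ᵐ ω ∂μ, ω ∉ B → ∀ θ ∈ grid,
      ∀ i ∈ Finset.Icc 1 (numRates (8 * G / 3) T),
        rate (8 * G / 3) i * ∑ t ∈ Finset.range T,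
          (μ[fun ω => linRegret g (t + 1) (p t) θ ω -
            4 * rate (8 * G / 3) i * linRegret g (t + 1) (p t) θ ω ^ 2 | F t]) ω ≤
        x + 2 * Real.log (grid.card * numRates (8 * G / 3) T) := by
  set E := 8 * G / 3 with hE
  set N := numRates E T with hNdef
  have hE0 : 0 < E := by positivity
  have hcard : (0 : ℝ) < grid.card := by exact_mod_cast hne.card_pos
  have hN' : (0 : ℝ) < N := by exact_mod_cast hN
  have hpb : ∀ t ω, p t ω ∈ l1Ball d := fun t ω => by
    rw [hp]; exact predict_mem hE0 hN hne hgrid (uniformPrior_pos hne) _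
  have hpm : ∀ t, Measurable[F t] (p t) := fun t => by
    rw [hp]; exact h.measurable_squint E T grid _ t
  let X : (Fin d → ℝ) → ℕ → ℕ → Ω → ℝ := fun θ i t ω => rate E i * linRegret g (t + 1) (p t) θ ω
  have hXm : ∀ θ i t, StronglyMeasurable[F (t + 1)] (X θ i t) := fun θ i t =>
    ((h.measurable_linRegret (Nat.le_add_left 1 t) ((hpm t).mono (F.mono t.le_succ) le_rfl)
      θ).const_mul _).stronglyMeasurable
  have hXb : ∀ θ ∈ grid, ∀ i ∈ Finset.Icc 1 N, ∀ t, ∀ᵐ ω ∂μ, |X θ i t ω| ≤ 2 / 5 := by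
    intro θ hθ i hi t
    filter_upwards [hG.abs_linRegret_le hG0.le (hpb t) (hgrid θ hθ) (Nat.le_add_left 1 t)] with ω hω
    have h1 := rate_le hE0 (Finset.mem_Icc.1 hi).1
    rw [abs_mul, abs_of_pos (rate_pos hE0 i)]
    -- With E = 8G/3 the left side is 3/(4e). One bound serves the potential (2/5) and the
    -- supermartingale (1/2).
    have h2 : (Real.exp 1 * E)⁻¹ * (2 * G) ≤ 2 / 5 := by
      rw [inv_mul_le_iff₀ (by positivity), hE]
      nlinarith [Real.exp_one_gt_d9]
    calc _ ≤ (Real.exp 1 * E)⁻¹ * (2 * G) := mul_le_mul h1 hω (abs_nonneg _) (by positivity)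
      _ ≤ _ := h2
  have hXb' : ∀ θ ∈ grid, ∀ i ∈ Finset.Icc 1 N, ∀ t, ∀ᵐ ω ∂μ, |X θ i t ω| ≤ 1 / 2 := by
    intro θ hθ i hi t
    filter_upwards [hXb θ hθ i hi t] with ω hω
    linarith
  -- The logarithm pays for the union bound over pairs; the potential contributes it a second time.
  set y := x + Real.log (grid.card * N) with hy
  refine ⟨⋃ j ∈ grid ×ˢ Finset.Icc 1 N,
    {ω | y ≤ ∑ t ∈ Finset.range T, expIncrement μ F (X j.1 j.2) t ω}, ?_, ?_⟩
  · refine (measure_biUnion_finset_le _ _).trans ?_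
    calc _ ≤ ∑ _j ∈ grid ×ˢ Finset.Icc 1 N, ENNReal.ofReal (Real.exp (-y)) :=
          Finset.sum_le_sum fun j hj => by
            obtain ⟨h1, h2⟩ := Finset.mem_product.1 hj
            exact measure_sum_expIncrement_ge_le (hXm _ _) (hXb' _ h1 _ h2) T y
      _ = ENNReal.ofReal (Real.exp (-x)) := by
          rw [Finset.sum_const, Finset.card_product, Nat.card_Icc, nsmul_eq_mul,
            ← ENNReal.ofReal_natCast, ← ENNReal.ofReal_mul (by positivity)]
          congr 1
          rw [hy, neg_add, Real.exp_add, Real.exp_neg (Real.log _), Real.exp_log (by positivity)]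
          push_cast
          field_simp
  · have hbounds : ∀ᵐ ω ∂μ, ∀ θ ∈ grid, ∀ i ∈ Finset.Icc 1 N, ∀ t, |X θ i t ω| ≤ 2 / 5 := by
      rw [Finset.eventually_all]
      intro θ hθ
      rw [Finset.eventually_all]
      intro i hi
      exact ae_all_iff.2 (hXb θ hθ i hi)
    have hcond : ∀ᵐ ω ∂μ, ∀ θ ∈ grid, ∀ i ∈ Finset.Icc 1 N, ∀ t,
        (μ[fun ω => X θ i t ω - 4 * X θ i t ω ^ 2 | F t]) ω = rate E i *
          (μ[fun ω => linRegret g (t + 1) (p t) θ ω -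
            4 * rate E i * linRegret g (t + 1) (p t) θ ω ^ 2 | F t]) ω := by
      rw [Finset.eventually_all]
      intro θ hθ
      rw [Finset.eventually_all]
      intro i hi
      refine ae_all_iff.2 fun t => ?_
      have heq : (fun ω => X θ i t ω - 4 * X θ i t ω ^ 2) = rate E i •
          (fun ω => linRegret g (t + 1) (p t) θ ω -
            4 * rate E i * linRegret g (t + 1) (p t) θ ω ^ 2) := by
        ext ω
        simp only [X, Pi.smul_apply, smul_eq_mul]
        ring
      rw [heq]
      exact condExp_smul _ _ _
    filter_upwards [hbounds, hcond] with ω h1 h2 hB θ hθ i hi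
    have h3 : ∑ t ∈ Finset.range T, expIncrement μ F (X θ i) t ω < y := by
      by_contra hcon
      push Not at hcon
      exact hB (Set.mem_biUnion (x := (θ, i)) (Finset.mem_coe.2 (Finset.mk_mem_product hθ hi)) hcon)
    have h4 := rate_mul_squintState_le hE0 hN (fun s => g s ω) T (grid := grid)
      (fun t _ θ' hθ' i' hi' => by
        have := h1 θ' hθ' i' hi' t
        simpa only [X, linRegret, hp] using this) hθ hi
    have h5 : rate E i * squintState E T grid (uniformPrior grid) (fun s => g s ω) T θ i =
        ∑ t ∈ Finset.range T, (X θ i t ω - X θ i t ω ^ 2) := by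
      rw [squintState_eq_sum, Finset.mul_sum]
      refine Finset.sum_congr rfl fun t _ => ?_
      simp only [X, linRegret, hp]
      ring
    have h6 : ∑ t ∈ Finset.range T, expIncrement μ F (X θ i) t ω = rate E i *
        ∑ t ∈ Finset.range T, (μ[fun ω => linRegret g (t + 1) (p t) θ ω -
          4 * rate E i * linRegret g (t + 1) (p t) θ ω ^ 2 | F t]) ω -
        ∑ t ∈ Finset.range T, (X θ i t ω - X θ i t ω ^ 2) := by
      rw [Finset.mul_sum, ← Finset.sum_sub_distrib]
      refine Finset.sum_congr rfl fun t _ => ?_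
      rw [← h2 θ hθ i hi t]
      unfold expIncrement
      ring
    rw [h6, ← h5] at h3
    linarith

end Event

/-! ### Numerical estimates -/

lemma sum_Icc_one_eq_sum_range (f : ℕ → ℝ) (T : ℕ) :
    ∑ t ∈ Finset.Icc 1 T, f t = ∑ t ∈ Finset.range T, f (t + 1) := by
  induction T with
  | zero => simp
  | succ n ih => rw [Finset.sum_Icc_succ_top (by omega), ih, Finset.sum_range_succ]

lemma two_le_card_grid {d : ℕ} (hd : 0 < d) {grid : Finset (Fin d → ℝ)}
    (hgrid : ∀ θ : Fin d → ℝ, l1norm θ = 1 → l0norm θ = 1 → θ ∈ grid) : 2 ≤ grid.card := by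
  have hcorner : ∀ c : ℝ, |c| = 1 → Pi.single (⟨0, hd⟩ : Fin d) c ∈ grid := by
    intro c hc
    have hc0 : c ≠ 0 := by rintro rfl; simp at hc
    apply hgrid
    · unfold l1norm
      rw [Finset.sum_eq_single ⟨0, hd⟩] <;> simp +contextual [hc]
    · unfold l0norm
      rw [Finset.card_eq_one]
      refine ⟨⟨0, hd⟩, ?_⟩
      ext j
      by_cases h : j = ⟨0, hd⟩ <;> simp [Pi.single_apply, h, hc0]
  refine Finset.one_lt_card.2 ⟨_, hcorner 1 (by simp), _, hcorner (-1) (by simp), fun h => ?_⟩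
  have := congrFun h ⟨0, hd⟩
  simp at this
  linarith

/-- The number of rates is at most 1 + log(GT) ≤ 2 log(GT), and the resulting log 2 is absorbed by
log Card, as the grid has two points. The constant 0.69 lies just below log 2. -/
lemma complexityTerm_bounds {d : ℕ} {grid : Finset (Fin d → ℝ)} {G x : ℝ} {T : ℕ}
    (hcard : 2 ≤ grid.card) (hx : 0 < x) (hGT : Real.exp 1 ≤ G * T)
    (hN : 1 ≤ numRates (8 * G / 3) T) :
    0.69 ≤ complexityTerm grid G T x ∧
      x + 2 * Real.log (grid.card * numRates (8 * G / 3) T) ≤ 4 * complexityTerm grid G T x := by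
  have hGT0 : 0 < G * T := (Real.exp_pos 1).trans_le hGT
  have hcard' : (2 : ℝ) ≤ grid.card := by exact_mod_cast hcard
  have hlog2 : Real.log 2 ≤ Real.log grid.card := Real.log_le_log (by norm_num) hcard'
  have hl1 : 1 ≤ Real.log (G * T) := by rwa [Real.le_log_iff_exp_le hGT0]
  have hll : 0 ≤ Real.log (Real.log (G * T)) := Real.log_nonneg hl1
  have hN' : (1 : ℝ) ≤ numRates (8 * G / 3) T := by exact_mod_cast hN
  have hNle : (numRates (8 * G / 3) T : ℝ) ≤ 2 * Real.log (G * T) := by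
    have h1 : 1 ≤ 8 * G / 3 * T := by
      have := Real.exp_one_gt_d9
      nlinarith
    have h2 : (numRates (8 * G / 3) T : ℝ) ≤ Real.log (8 * G / 3 * T) :=
      Nat.floor_le (Real.log_nonneg h1)
    have h3 : Real.log (8 * G / 3 * T) = Real.log (8 / 3) + Real.log (G * T) := by
      rw [← Real.log_mul (by norm_num) hGT0.ne']
      congr 1; ring
    have h4 : Real.log (8 / 3) ≤ 1 := by
      rw [Real.log_le_iff_le_exp (by norm_num)]
      linarith [Real.exp_one_gt_d9]
    linarith
  have hlogN : Real.log (numRates (8 * G / 3) T) ≤ Real.log 2 + Real.log (Real.log (G * T)) := by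
    rw [← Real.log_mul (by norm_num) (by linarith)]
    exact Real.log_le_log (by linarith) hNle
  rw [Real.log_mul (by linarith) (by linarith)]
  have := Real.log_two_gt_d9
  unfold complexityTerm
  constructor <;> linarith

/-! ### Numerical form of the bounds -/

/-- The harmonic target for the learning rate is above the smallest one, unless the trivial bound
`2 G` suffices. -/
lemma exists_rate_fast {G ρ p s : ℝ} {T : ℕ} (hE : 1 ≤ 8 * G / 3) (hGT : Real.exp 1 ≤ G * T)
    (hρ : 0 < ρ) (hp0 : 0 ≤ p) (hp1 : p ≤ 1) (hs : 0 < s) (hsT : 0.69 ≤ s ^ 2 * T)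
    (hbig : 4000 * (ρ + G * p * s + G * s ^ 2) < 2 * G + ρ) :
    ∃ i ∈ Finset.Icc 1 (numRates (8 * G / 3) T), 128 * ρ * rate (8 * G / 3) i ≤ s ^ 2 ∧
      256 * G * rate (8 * G / 3) i ≤ 1 ∧ G * p * rate (8 * G / 3) i ≤ 4 * s ∧
      s ^ 2 / rate (8 * G / 3) i ≤ 400 * ρ + G * p * s + 800 * (G * s ^ 2) := by
  have hG : 0 < G := by linarith
  have he1 := Real.exp_one_gt_d9
  have he2 := Real.exp_one_lt_d9
  have hT0 : (0 : ℝ) < T := by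
    by_contra hcon
    push Not at hcon
    nlinarith
  have hT : (1 : ℝ) ≤ T := by
    have : 0 < T := by exact_mod_cast hT0
    exact_mod_cast this
  have hs2 : 0 < s ^ 2 := by positivity
  have hGps : 0 ≤ G * p * s := by positivity
  have hGs2 : 0 < G * s ^ 2 := by positivity
  set E := 8 * G / 3 with hEdef
  -- 1/Q stands in for the minimum of the admissible rates s²/(128ρ), 1/(256G) and 4s/(Gp). The sum
  -- form makes s²Q split into multiples of the three target terms.
  set Q : ℝ := 128 * ρ / s ^ 2 + 256 * G + G * p / (4 * s) with hQ
  have hQ1 : 0 ≤ 128 * ρ / s ^ 2 := by positivity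
  have hQ3 : 0 ≤ G * p / (4 * s) := by positivity
  have hQ0 : 0 < Q := by linarith
  have hET : Real.exp 1 ≤ E * T := by rw [hEdef]; nlinarith
  -- The terms of Q are at most 0.30, 0.30 and 0.32 times GT, and 2.72 · 0.92 < 8/3. The first two
  -- use `hbig`, which forces ρ ≤ 2G/3999 and s² ≤ 1/2000.
  have hlo : Real.exp 1 / (E * T) ≤ 1 / Q := by
    rw [div_le_div_iff₀ (by positivity) hQ0]
    have b1 : 128 * ρ / s ^ 2 ≤ 3 / 10 * (G * T) := by
      rw [div_le_iff₀ hs2]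
      have h1 : ρ ≤ 2 * G / 3999 := by linarith
      have h2 : 0.69 * G ≤ G * (s ^ 2 * T) := by nlinarith
      nlinarith
    have b2 : 256 * G ≤ 3 / 10 * (G * T) := by
      have h1 : 4000 * (G * s ^ 2) ≤ 2 * G := by linarith
      have h2 : 4000 * s ^ 2 ≤ 2 := by nlinarith
      have h3 : 1380 ≤ (T : ℝ) := by nlinarith
      nlinarith
    have b3 : G * p / (4 * s) ≤ 32 / 100 * (G * T) := by
      rw [div_le_iff₀ (by positivity)]
      -- (sT)² = s²T · T ≥ 0.69 > 0.8², since T ≥ 1.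
      have h1 : 0.8 ≤ s * T := by
        by_contra hcon
        push Not at hcon
        nlinarith
      have h2 : 0.8 * G ≤ G * (s * T) := by nlinarith
      nlinarith
    have : Q ≤ 92 / 100 * (G * T) := by linarith
    have hGT0 : 0 < G * T := by positivity
    calc Real.exp 1 * Q ≤ Real.exp 1 * (92 / 100 * (G * T)) := by gcongr
      _ ≤ 2.72 * (92 / 100 * (G * T)) := by gcongr; linarith
      _ ≤ 1 * (E * T) := by rw [hEdef]; nlinarith
  obtain ⟨i, hi, h1, h2⟩ := exists_rate hE hET hlo
  have hr := rate_pos (show 0 < E by positivity) i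
  have h3 : Q * rate E i ≤ 1 := by
    rw [le_div_iff₀ hQ0] at h1
    linarith
  have hr1 : 0 ≤ 128 * ρ / s ^ 2 * rate E i := by positivity
  have hr2 : 0 ≤ 256 * G * rate E i := by positivity
  have hr3 : 0 ≤ G * p / (4 * s) * rate E i := by positivity
  have h4 : 128 * ρ / s ^ 2 * rate E i + 256 * G * rate E i + G * p / (4 * s) * rate E i ≤ 1 := by
    rw [hQ] at h3; linarith
  refine ⟨i, hi, ?_, by linarith, ?_, ?_⟩
  · have h5 : 128 * ρ / s ^ 2 * rate E i ≤ 1 := by linarith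
    rw [div_mul_eq_mul_div, div_le_iff₀ hs2] at h5
    linarith
  · have h5 : G * p / (4 * s) * rate E i ≤ 1 := by linarith
    rw [div_mul_eq_mul_div, div_le_iff₀ (by positivity)] at h5
    linarith
  · have h5 : 1 / rate E i ≤ Real.exp 1 * (Q + E) := by
      rw [div_div_eq_mul_div, div_one] at h2
      linarith
    have h6 : s ^ 2 / rate E i ≤ s ^ 2 * (Real.exp 1 * (Q + E)) := by
      rw [div_eq_mul_one_div]; gcongr
    have h7 : s ^ 2 * (Q + E) = 128 * ρ + G * p * s / 4 + (256 + 8 / 3) * (G * s ^ 2) := by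
      rw [hQ, hEdef]; field_simp; ring
    calc _ ≤ Real.exp 1 * (s ^ 2 * (Q + E)) := by linarith
      _ ≤ 2.72 * (s ^ 2 * (Q + E)) := by gcongr; linarith
      _ ≤ _ := by rw [h7]; linarith

/-- A rate of order s/G balances s²/c against cG². Since s²T is bounded below, this target is never
under the smallest rate, so no trivial case has to be excluded. -/
lemma exists_rate_slow {G s : ℝ} {T : ℕ} (hE : 1 ≤ 8 * G / 3) (hGT : Real.exp 1 ≤ G * T)
    (hs : 0 < s) (hsT : 0.69 ≤ s ^ 2 * T) :
    ∃ i ∈ Finset.Icc 1 (numRates (8 * G / 3) T), G * rate (8 * G / 3) i ≤ 4 * s ∧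
      s ^ 2 / rate (8 * G / 3) i ≤ G * s + 8 * (G * s ^ 2) := by
  have hG : 0 < G := by linarith
  have he1 := Real.exp_one_gt_d9
  have he2 := Real.exp_one_lt_d9
  have hT0 : (0 : ℝ) < T := by
    by_contra hcon
    push Not at hcon
    nlinarith
  have hT : (1 : ℝ) ≤ T := by
    have : 0 < T := by exact_mod_cast hT0
    exact_mod_cast this
  have hGs2 : 0 < G * s ^ 2 := by positivity
  have hGs : 0 < G * s := by positivity
  set E := 8 * G / 3 with hEdef
  have hET : Real.exp 1 ≤ E * T := by rw [hEdef]; nlinarith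
  have hlo : Real.exp 1 / (E * T) ≤ 4 * s / G := by
    rw [div_le_div_iff₀ (by positivity) hG]
    have h1 : 0.8 ≤ s * T := by
      by_contra hcon
      push Not at hcon
      nlinarith
    rw [hEdef]
    have h2 : 0.8 * G ≤ G * (s * T) := by nlinarith
    nlinarith
  obtain ⟨i, hi, h1, h2⟩ := exists_rate hE hET hlo
  refine ⟨i, hi, ?_, ?_⟩
  · rw [le_div_iff₀ hG] at h1
    linarith
  · have h6 : s ^ 2 / rate E i ≤ s ^ 2 * (Real.exp 1 / (4 * s / G) + Real.exp 1 * E) := by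
      rw [div_eq_mul_one_div]; gcongr
    have h7 : s ^ 2 * (Real.exp 1 / (4 * s / G) + Real.exp 1 * E) =
        Real.exp 1 * (G * s / 4 + 8 / 3 * (G * s ^ 2)) := by
      rw [hEdef]; field_simp
    rw [h7] at h6
    have h8 : Real.exp 1 * (G * s / 4 + 8 / 3 * (G * s ^ 2)) ≤
        2.72 * (G * s / 4 + 8 / 3 * (G * s ^ 2)) := by gcongr; linarith
    linarith

/-! ### Average risk at a fixed point -/

section Risk

variable {d : ℕ} {Ω : Type*} {m : MeasurableSpace Ω} {μ : Measure Ω} {F : Filtration ℕ m}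
  {ℓ : ℕ → Ω → (Fin d → ℝ) → ℝ} {g : ℕ → Ω → (Fin d → ℝ) → (Fin d → ℝ)} {G : ℝ}

/-- The average conditional regret of the predictions `p` with respect to `θ`. -/
noncomputable def condRegret (μ : Measure Ω) (F : Filtration ℕ m) (ℓ : ℕ → Ω → (Fin d → ℝ) → ℝ)
    (p : ℕ → Ω → (Fin d → ℝ)) (T : ℕ) (θ : Fin d → ℝ) (ω : Ω) : ℝ :=
  1 / (T : ℝ) * ∑ t ∈ Finset.range T,
    ((μ[fun ω => ℓ (t + 1) ω (p t ω) | F t]) ω - (μ[fun ω => ℓ (t + 1) ω θ | F t]) ω)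

/-- Two weight systems are allowed so that the nearby grid point and the corners can use different
rates. Summing the pathwise domination over rounds leaves only the event bounds for grid points. -/
lemma condRegret_le_of_dominated [IsProbabilityMeasure μ]
    (h : IsRandomConvexLoss μ F ℓ g) (hG : LipschitzLoss μ g G) (hG0 : 0 ≤ G) {α β ρ η : ℝ}
    (hα : 0 < α) (hβ0 : 0 ≤ β) (hβ1 : β ≤ 1) (hw : WeakExpConcave μ F ℓ g α β) (hρ : 0 < ρ)
    (hη0 : 0 ≤ η) (hη : 4 * η ≤ α * ρ ^ (1 - β)) (hηG : 8 * G * η ≤ 1)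
    {p : ℕ → Ω → (Fin d → ℝ)} (hp : ∀ t, Measurable[F t] (p t)) (hpb : ∀ t ω, p t ω ∈ l1Ball d)
    {θ : Fin d → ℝ} (hθ : θ ∈ l1Ball d) {grid : Finset (Fin d → ℝ)}
    (hgrid : ∀ θ ∈ grid, θ ∈ l1Ball d) {T : ℕ} (hT : 0 < T) {v₁ v₂ : (Fin d → ℝ) → ℝ}
    (hv₁ : ∀ j ∈ grid, 0 ≤ v₁ j) (hv₂ : ∀ j ∈ grid, 0 ≤ v₂ j) {c₁ c₂ : ℝ} (hc₁ : 0 < c₁)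
    (hc₂ : 0 < c₂) (c b : ℝ)
    (hdom : ∀ h p : Fin d → ℝ, (∀ i, |h i| ≤ G) → p ∈ l1Ball d →
      h ⬝ᵥ (p - θ) - η * (h ⬝ᵥ (p - θ)) ^ 2 ≤
        ∑ j ∈ grid, (v₁ j * (h ⬝ᵥ (p - j) - 4 * c₁ * (h ⬝ᵥ (p - j)) ^ 2) +
          v₂ j * (h ⬝ᵥ (p - j) - 4 * c₂ * (h ⬝ᵥ (p - j)) ^ 2)) + c) :
    ∀ᵐ ω ∂μ, (∀ j ∈ grid, ∀ c ∈ ({c₁, c₂} : Set ℝ), c * ∑ t ∈ Finset.range T,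
        (μ[fun ω => linRegret g (t + 1) (p t) j ω -
          4 * c * linRegret g (t + 1) (p t) j ω ^ 2 | F t]) ω ≤ b * T) →
      condRegret μ F ℓ p T θ ω ≤
        (∑ j ∈ grid, v₁ j) * (b / c₁) + (∑ j ∈ grid, v₂ j) * (b / c₂) + c + ρ := by
  have hT' : (0 : ℝ) < T := by exact_mod_cast hT
  have key := fun t : ℕ => condExp_loss_sub_le h hG hG0 hα hβ0 hβ1 hw hρ hη0 hη hηG
    (Nat.le_add_left 1 t) (p := p t) (hp t) (hpb t) hθ hgrid v₁ v₂ (4 * c₁) (4 * c₂) c hdom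
  filter_upwards [ae_all_iff.2 key] with ω hω hgood
  simp only [Nat.add_sub_cancel] at hω
  set Y₁ : ℕ → (Fin d → ℝ) → ℝ := fun t j => (μ[fun ω => linRegret g (t + 1) (p t) j ω -
    4 * c₁ * linRegret g (t + 1) (p t) j ω ^ 2 | F t]) ω with hY₁
  set Y₂ : ℕ → (Fin d → ℝ) → ℝ := fun t j => (μ[fun ω => linRegret g (t + 1) (p t) j ω -
    4 * c₂ * linRegret g (t + 1) (p t) j ω ^ 2 | F t]) ω with hY₂
  have h1 : ∀ j ∈ grid, ∑ t ∈ Finset.range T, Y₁ t j ≤ b / c₁ * T := fun j hj => by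
    rw [div_mul_eq_mul_div, le_div_iff₀' hc₁]
    exact hgood j hj c₁ (by simp)
  have h2 : ∀ j ∈ grid, ∑ t ∈ Finset.range T, Y₂ t j ≤ b / c₂ * T := fun j hj => by
    rw [div_mul_eq_mul_div, le_div_iff₀' hc₂]
    exact hgood j hj c₂ (by simp)
  unfold condRegret
  rw [one_div, inv_mul_le_iff₀ hT']
  calc _ ≤ ∑ t ∈ Finset.range T, (∑ j ∈ grid, (v₁ j * Y₁ t j + v₂ j * Y₂ t j) + c + ρ) :=
        Finset.sum_le_sum fun t _ => hω t
    _ = ∑ j ∈ grid, (v₁ j * ∑ t ∈ Finset.range T, Y₁ t j +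
          v₂ j * ∑ t ∈ Finset.range T, Y₂ t j) + T * (c + ρ) := by
        simp only [Finset.sum_add_distrib, Finset.mul_sum, Finset.sum_const, Finset.card_range,
          nsmul_eq_mul]
        rw [Finset.sum_comm, Finset.sum_comm (f := fun t j => v₂ j * Y₂ t j)]
        ring
    _ ≤ ∑ j ∈ grid, (v₁ j * (b / c₁ * T) + v₂ j * (b / c₂ * T)) + T * (c + ρ) := by
        gcongr with j hj j hj
        · exact hv₁ j hj
        · exact h1 j hj
        · exact hv₂ j hj
        · exact h2 j hj
    _ = _ := by
        rw [Finset.sum_add_distrib, ← Finset.sum_mul, ← Finset.sum_mul]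
        ring

lemma dotProduct_sub_eq_sum {grid : Finset (Fin d → ℝ)} {w : (Fin d → ℝ) → ℝ} {ξ : Fin d → ℝ}
    (hw : ∑ j ∈ grid, w j = 1) (hξ : ∑ j ∈ grid, w j • j = ξ) (h p : Fin d → ℝ) :
    h ⬝ᵥ (p - ξ) = ∑ j ∈ grid, w j * (h ⬝ᵥ (p - j)) := by
  simp only [dotProduct_sub, mul_sub, Finset.sum_sub_distrib]
  rw [← Finset.sum_mul, hw, one_mul, ← hξ, dotProduct_sum]
  simp

/-- The regret is affine in the comparator, and inserting the quadratic term at each grid point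
costs at most 4c(2G)². -/
lemma dotProduct_sub_le_sum {grid : Finset (Fin d → ℝ)} (hgrid : ∀ θ ∈ grid, θ ∈ l1Ball d)
    {w : (Fin d → ℝ) → ℝ} {ξ : Fin d → ℝ} (hw0 : ∀ j ∈ grid, 0 ≤ w j)
    (hw : ∑ j ∈ grid, w j = 1) (hξ : ∑ j ∈ grid, w j • j = ξ) (hG0 : 0 ≤ G) {c : ℝ} (hc : 0 ≤ c)
    {h p : Fin d → ℝ} (hh : ∀ i, |h i| ≤ G) (hp : p ∈ l1Ball d) :
    h ⬝ᵥ (p - ξ) ≤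
      ∑ j ∈ grid, w j * (h ⬝ᵥ (p - j) - 4 * c * (h ⬝ᵥ (p - j)) ^ 2) + 16 * c * G ^ 2 := by
  rw [dotProduct_sub_eq_sum hw hξ]
  have h1 : ∀ j ∈ grid, w j * (h ⬝ᵥ (p - j)) ≤
      w j * (h ⬝ᵥ (p - j) - 4 * c * (h ⬝ᵥ (p - j)) ^ 2) + w j * (16 * c * G ^ 2) := by
    intro j hj
    have h2 : |h ⬝ᵥ (p - j)| ≤ 2 * G := (abs_dotProduct_le hh _).trans
      (by nlinarith [l1norm_sub_le_two hp (hgrid j hj)])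
    have h3 : (h ⬝ᵥ (p - j)) ^ 2 ≤ (2 * G) ^ 2 := sq_le_sq' (abs_le.1 h2).1 (abs_le.1 h2).2
    have h4 := mul_le_mul_of_nonneg_left h3 hc
    rw [← mul_add]
    exact mul_le_mul_of_nonneg_left (by linarith) (hw0 j hj)
  refine (Finset.sum_le_sum h1).trans_eq ?_
  rw [Finset.sum_add_distrib, ← Finset.sum_mul, hw, one_mul]

/-- The accelerable bound at a fixed point. -/
lemma condRegret_le [IsProbabilityMeasure μ] (hd : 0 < d)
    (h : IsRandomConvexLoss μ F ℓ g) (hG : LipschitzLoss μ g G) {α β ρ s : ℝ}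
    (hα : 0 < α) (hβ0 : 0 ≤ β) (hβ1 : β ≤ 1) (hw : WeakExpConcave μ F ℓ g α β) (hρ : 0 < ρ)
    {T : ℕ} (hE : 1 ≤ 8 * G / 3) (hGT : Real.exp 1 ≤ G * T) (hs : 0 < s)
    (hsT : 0.69 ≤ s ^ 2 * T) (hsρ : α * ρ ^ (1 - β) = s ^ 2 / ρ)
    {p : ℕ → Ω → (Fin d → ℝ)} (hp : ∀ t, Measurable[F t] (p t)) (hpb : ∀ t ω, p t ω ∈ l1Ball d)
    {grid : Finset (Fin d → ℝ)} (hgrid : ∀ θ ∈ grid, θ ∈ l1Ball d)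
    (hcorner : ∀ θ : Fin d → ℝ, l1norm θ = 1 → l0norm θ = 1 → θ ∈ grid)
    {k : Fin d → ℝ} (hk : k ∈ grid) {π : ℝ} (hπ : π ∈ Set.Icc (0 : ℝ) 1) {ξ : Fin d → ℝ}
    (hξ : ξ ∈ l1Ball d) :
    ∀ᵐ ω ∂μ, (∀ j ∈ grid, ∀ i ∈ Finset.Icc 1 (numRates (8 * G / 3) T),
        rate (8 * G / 3) i * ∑ t ∈ Finset.range T,
        (μ[fun ω => linRegret g (t + 1) (p t) j ω -
          4 * rate (8 * G / 3) i * linRegret g (t + 1) (p t) j ω ^ 2 | F t]) ω ≤ 4 * s ^ 2 * T) →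
      condRegret μ F ℓ p T ((1 - π) • k + π • ξ) ω ≤
        4000 * (ρ + G * π * s + G * s ^ 2) := by
  obtain ⟨hπ0, hπ1⟩ := hπ
  have hG0 : 0 < G := by linarith
  have hT : 0 < T := by
    rcases Nat.eq_zero_or_pos T with h0 | h0
    · rw [h0] at hGT
      have := Real.exp_pos 1
      simp at hGT
      linarith
    · exact h0
  have hE0 : 0 < 8 * G / 3 := by positivity
  have hθ : (1 - π) • k + π • ξ ∈ l1Ball d :=
    convex_l1Ball (hgrid k hk) hξ (by linarith) hπ0 (by ring)
  have hαρ : 0 < α * ρ ^ (1 - β) := by positivity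
  have hGπs : 0 ≤ G * π * s := by positivity
  have hGs2 : 0 < G * s ^ 2 := by positivity
  obtain ⟨i', hi', hr1, hr2⟩ := exists_rate_slow hE hGT hs hsT
  have hr' := rate_pos hE0 i'
  set c₂ := rate (8 * G / 3) i' with hc₂
  have hc₂G : c₂ * G ^ 2 ≤ 4 * s * G := by nlinarith
  -- Zero weights and the bound 2G on the linearised regret settle the first case; its failure is
  -- what `exists_rate_fast` needs.
  by_cases hbig : 2 * G + ρ ≤ 4000 * (ρ + G * π * s + G * s ^ 2)
  · have := condRegret_le_of_dominated h hG hG0.le hα hβ0 hβ1 hw hρ (η := 0) le_rfl (by linarith)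
      (by linarith) hp hpb hθ hgrid hT (v₁ := 0) (v₂ := 0) (by simp) (by simp) hr' hr' (2 * G)
      (4 * s ^ 2) (by
        intro h p hh hp
        have := (abs_le.1 (abs_dotProduct_le hh (p - ((1 - π) • k + π • ξ)))).2
        have := mul_le_mul_of_nonneg_left (l1norm_sub_le_two hp hθ) hG0.le
        simp only [Pi.zero_apply, zero_mul, add_zero, Finset.sum_const_zero, zero_add, sub_zero]
        linarith)
    filter_upwards [this] with ω hω hgood
    have h1 := hω fun j hj c hc => by
      have : c = c₂ := by simpa using hc
      rw [this]
      exact hgood j hj i' hi'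
    simp only [Pi.zero_apply, Finset.sum_const_zero, zero_mul, zero_add] at h1
    linarith
  · push Not at hbig
    rcases le_or_gt π (1 / 2) with hπ2 | hπ2
    · obtain ⟨i, hi, hq1, hq2, hq3, hq4⟩ := exists_rate_fast hE hGT hρ hπ0 hπ1 hs hsT hbig
      have hr := rate_pos hE0 i
      set c₁ := rate (8 * G / 3) i with hc₁
      obtain ⟨w, hw0, hw1, hwξ⟩ := Finset.mem_convexHull'.1 (l1Ball_subset_convexHull hd hcorner hξ)
      have hdom : ∀ h p : Fin d → ℝ, (∀ i, |h i| ≤ G) → p ∈ l1Ball d →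
          h ⬝ᵥ (p - ((1 - π) • k + π • ξ)) - 32 * c₁ * (h ⬝ᵥ (p - ((1 - π) • k + π • ξ))) ^ 2 ≤
          ∑ j ∈ grid, ((if j = k then 1 - π else 0) *
              (h ⬝ᵥ (p - j) - 4 * c₁ * (h ⬝ᵥ (p - j)) ^ 2) +
            (π * w j) * (h ⬝ᵥ (p - j) - 4 * c₂ * (h ⬝ᵥ (p - j)) ^ 2)) +
            (π * (16 * c₂ * G ^ 2) + 128 * c₁ * π ^ 2 * G ^ 2) := by
        intro h p hh hp
        have e1 : p - ((1 - π) • k + π • ξ) = (1 - π) • (p - k) + π • (p - ξ) := by module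
        have e2 : |h ⬝ᵥ (p - ξ)| ≤ 2 * G := (abs_dotProduct_le hh _).trans
          (by nlinarith [l1norm_sub_le_two hp hξ])
        have e3 := sub_sq_convexComb_le (r := h ⬝ᵥ (p - k)) hπ0 hπ2 hr.le e2
        have e4 := mul_le_mul_of_nonneg_left
          (dotProduct_sub_le_sum hgrid hw0 hw1 hwξ hG0.le hr'.le hh hp) hπ0
        rw [e1, dotProduct_add, dotProduct_smul, dotProduct_smul, smul_eq_mul, smul_eq_mul]
        rw [Finset.sum_add_distrib]
        simp only [ite_mul, zero_mul, Finset.sum_ite_eq', hk, if_true, mul_assoc π, ← Finset.mul_sum]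
        linarith
      -- With η = 32c₁ the side conditions read 128ρc₁ ≤ s² and 256Gc₁ ≤ 1, two of the guarantees on
      -- the fast rate.
      have := condRegret_le_of_dominated h hG hG0.le hα hβ0 hβ1 hw hρ (η := 32 * c₁)
        (by positivity) (by rw [hsρ, le_div_iff₀ hρ]; linarith)
        (by linarith) hp hpb hθ hgrid hT
        (fun j _ => by split_ifs <;> linarith) (fun j hj => mul_nonneg hπ0 (hw0 j hj)) hr hr' _
        (4 * s ^ 2) hdom
      filter_upwards [this] with ω hω hgood
      have h1 := hω fun j hj c hc => by
        rcases hc with hc | hc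
        · rw [hc]; exact hgood j hj i hi
        · rw [Set.mem_singleton_iff.1 hc]; exact hgood j hj i' hi'
      rw [← Finset.mul_sum, hw1, mul_one] at h1
      simp only [Finset.sum_ite_eq', hk, if_true] at h1
      have e1 : (1 - π) * (4 * s ^ 2 / c₁) ≤ 4 * (400 * ρ + G * π * s + 800 * (G * s ^ 2)) := by
        have : 0 ≤ s ^ 2 / c₁ := by positivity
        have := mul_le_of_le_one_left this (show 1 - π ≤ 1 by linarith)
        rw [mul_div_assoc]
        linarith
      have e2 : π * (4 * s ^ 2 / c₂) ≤ 4 * (G * π * s + 8 * (G * s ^ 2)) := by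
        have := mul_le_mul_of_nonneg_left hr2 hπ0
        have := mul_le_of_le_one_left hGs2.le hπ1
        rw [mul_div_assoc]
        linarith
      have e3 : π * (16 * c₂ * G ^ 2) ≤ 64 * (G * π * s) := by
        have := mul_le_mul_of_nonneg_left hc₂G hπ0
        linarith
      have e4 : 128 * c₁ * π ^ 2 * G ^ 2 ≤ 512 * (G * π * s) := by
        have := mul_le_mul_of_nonneg_left hq3 (mul_nonneg hG0.le hπ0)
        calc 128 * c₁ * π ^ 2 * G ^ 2 = 128 * (G * π * (G * π * c₁)) := by ring
          _ ≤ 128 * (G * π * (4 * s)) := by linarith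
          _ = 512 * (G * π * s) := by ring
      linarith
    -- For π > 1/2 no quadratic gain is needed: the whole point is written as a mixture of grid
    -- points at the slow rate, and Gs ≤ 2Gπs.
    · obtain ⟨w, hw0, hw1, hwθ⟩ := Finset.mem_convexHull'.1 (l1Ball_subset_convexHull hd hcorner hθ)
      have := condRegret_le_of_dominated h hG hG0.le hα hβ0 hβ1 hw hρ (η := 0) le_rfl (by linarith)
        (by linarith) hp hpb hθ hgrid hT (v₁ := 0) (v₂ := w) (by simp) hw0 hr' hr' (16 * c₂ * G ^ 2)
        (4 * s ^ 2) (by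
          intro h p hh hp
          have := dotProduct_sub_le_sum hgrid hw0 hw1 hwθ hG0.le hr'.le hh hp
          simpa using this)
      filter_upwards [this] with ω hω hgood
      have h1 := hω fun j hj c hc => by
        have : c = c₂ := by simpa using hc
        rw [this]
        exact hgood j hj i' hi'
      simp only [Pi.zero_apply, Finset.sum_const_zero, zero_mul, zero_add, hw1, one_mul] at h1
      have e1 : G * s ≤ 2 * (G * π * s) := by nlinarith [mul_pos hG0 hs]
      rw [mul_div_assoc] at h1
      linarith

end Risk

/-! ### Uniformity over the ball and the main theorem -/

/-- There is a universal constant `C` such that the average risk of the algorithm, run on `grid`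
with the uniform prior and `E = 8G/3`, satisfies the accelerable bound for all `θ` in the unit
`ℓ₁`-ball simultaneously, outside an event of probability at most `e^{-x}`. -/
theorem theorem2 :
    ∃ C : ℝ, 0 < C ∧
      ∀ (d : ℕ) (_ : 0 < d) (Ω : Type*) (m : MeasurableSpace Ω) (μ : Measure Ω)
        (_ : IsProbabilityMeasure μ) (F : Filtration ℕ m)
        (ℓ : ℕ → Ω → (Fin d → ℝ) → ℝ) (g : ℕ → Ω → (Fin d → ℝ) → (Fin d → ℝ))
        (G α β x : ℝ) (T : ℕ) (grid : Finset (Fin d → ℝ)),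
        IsRandomConvexLoss μ F ℓ g →
        LipschitzLoss μ g G →
        0 < α → 0 ≤ β → β ≤ 1 →
        WeakExpConcave μ F ℓ g α β →
        0 < x →
        1 ≤ 8 * G / 3 →
        Real.exp 1 ≤ G * T →
        (∀ θ ∈ grid, θ ∈ l1Ball d) →
        (∀ θ : Fin d → ℝ, l1norm θ = 1 → l0norm θ = 1 → θ ∈ grid) →
        (∃ L : ℕ → (Fin d → ℝ) → Ω → ℝ, IsCondRisk μ F ℓ L) ∧
        ∀ L : ℕ → (Fin d → ℝ) → Ω → ℝ, IsCondRisk μ F ℓ L →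
          μ {ω | ¬ ∀ θ ∈ l1Ball d,
              avgRisk μ F ℓ
                  (fun t ω' => squint (8 * G / 3) T grid (uniformPrior grid)
                    (fun s => g s ω') t) L T θ ω ≤
                C * ((complexityTerm grid G T x / (α * T)) ^ (1 / (2 - β)) +
                  G * gridAccel θ grid * Real.sqrt (complexityTerm grid G T x / T) +
                  complexityTerm grid G T x * G / T)} ≤
            ENNReal.ofReal (Real.exp (-x)) := by
  refine ⟨4000, by norm_num, ?_⟩
  intro d hd Ω m μ _ F ℓ g G α β x T grid h hG hα hβ0 hβ1 hw hx hE hGT hgrid hcorner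
  have hG0 : 0 < G := by linarith
  refine ⟨exists_isCondRisk h hG hG0.le, ?_⟩
  intro L hL
  have hT : 0 < T := by
    rcases Nat.eq_zero_or_pos T with h0 | h0
    · rw [h0] at hGT
      have := Real.exp_pos 1
      simp at hGT
      linarith
    · exact h0
  have hT' : (0 : ℝ) < T := by exact_mod_cast hT
  have hN : 1 ≤ numRates (8 * G / 3) T := one_le_numRates (by nlinarith [Real.exp_pos 1])
  have hcard := two_le_card_grid hd hcorner
  have hne : grid.Nonempty := Finset.card_pos.1 (by omega)
  obtain ⟨ha, hb⟩ := complexityTerm_bounds hcard hx hGT hN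
  set a := complexityTerm grid G T x with hadef
  set p : ℕ → Ω → (Fin d → ℝ) := fun t ω' => squint (8 * G / 3) T grid (uniformPrior grid)
    (fun s => g s ω') t with hp
  have ha0 : 0 < a := by linarith
  set s := Real.sqrt (a / T) with hs
  have hs0 : 0 < s := Real.sqrt_pos.2 (by positivity)
  have hs2 : s ^ 2 = a / T := Real.sq_sqrt (by positivity)
  have hs2T : s ^ 2 * T = a := by rw [hs2]; field_simp
  set ρ := (a / (α * T)) ^ (1 / (2 - β)) with hρdef
  have hρ : 0 < ρ := by positivity
  -- The choice of ρ solves αρ^(2-β) = s², so the fast rate αρ^(1-β) is s²/ρ and its regret s²/rate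
  -- has the order of ρ.
  have hsρ : α * ρ ^ (1 - β) = s ^ 2 / ρ := by
    rw [eq_div_iff hρ.ne', mul_assoc]
    nth_rewrite 2 [← Real.rpow_one ρ]
    rw [← Real.rpow_add hρ, hρdef, ← Real.rpow_mul (by positivity)]
    have : 1 / (2 - β) * (1 - β + 1) = 1 := by
      have : 2 - β ≠ 0 := by linarith
      field_simp
      ring
    rw [this, Real.rpow_one, hs2]
    field_simp
  have hpb : ∀ t ω, p t ω ∈ l1Ball d := fun t ω =>
    predict_mem (by linarith) hN hne hgrid (uniformPrior_pos hne) _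
  have hpm : ∀ t, Measurable[F t] (p t) := fun t => h.measurable_squint _ T grid _ t
  obtain ⟨B, hB, hgood⟩ := exists_regret_event h hG hG0 hN hne hgrid x hp
  refine le_trans (measure_mono_ae ?_) hB
  have : Nonempty (l1Ball d) := ⟨⟨0, zero_mem_l1Ball⟩⟩
  -- The bound is continuous in the pair (π, ξ), with π in place of the accelerability, so no
  -- continuity of `gridAccel` in θ is required.
  let q : (Fin d → ℝ) → (Set.Icc (0 : ℝ) 1 × l1Ball d) → (Fin d → ℝ) := fun k z => (1 - (z.1 : ℝ)) • k + (z.1 : ℝ) • (z.2 : Fin d → ℝ)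
  have hq : ∀ k ∈ grid, ∀ z : (Set.Icc (0 : ℝ) 1 × l1Ball d), q k z ∈ l1Ball d := fun k hk z =>
    convex_l1Ball (hgrid k hk) z.2.2 (by linarith [z.1.2.2]) z.1.2.1 (by ring)
  have hdense : ∀ᵐ ω ∂μ, ∀ k ∈ grid, ∀ n : ℕ,
      (∀ j ∈ grid, ∀ i ∈ Finset.Icc 1 (numRates (8 * G / 3) T),
        rate (8 * G / 3) i * ∑ t ∈ Finset.range T,
        (μ[fun ω => linRegret g (t + 1) (p t) j ω -
          4 * rate (8 * G / 3) i * linRegret g (t + 1) (p t) j ω ^ 2 | F t]) ω ≤ 4 * s ^ 2 * T) →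
      condRegret μ F ℓ p T (q k (TopologicalSpace.denseSeq (Set.Icc (0 : ℝ) 1 × l1Ball d) n)) ω ≤
        4000 * (ρ + G * ((TopologicalSpace.denseSeq (Set.Icc (0 : ℝ) 1 × l1Ball d) n).1 : ℝ) * s + G * s ^ 2) := by
    rw [Finset.eventually_all]
    intro k hk
    exact ae_all_iff.2 fun n => condRegret_le hd h hG hα hβ0 hβ1 hw hρ hE hGT hs0
      (by rw [hs2T]; exact ha) hsρ hpm hpb hgrid hcorner hk (TopologicalSpace.denseSeq (Set.Icc (0 : ℝ) 1 × l1Ball d) n).1.2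
      (TopologicalSpace.denseSeq (Set.Icc (0 : ℝ) 1 × l1Ball d) n).2.2
  have hversion : ∀ᵐ ω ∂μ, ∀ k ∈ grid, ∀ n t : ℕ,
      L (t + 1) (q k (TopologicalSpace.denseSeq (Set.Icc (0 : ℝ) 1 × l1Ball d) n)) ω =
        (μ[fun ω => ℓ (t + 1) ω (q k (TopologicalSpace.denseSeq (Set.Icc (0 : ℝ) 1 × l1Ball d) n)) | F t]) ω := by
    rw [Finset.eventually_all]
    intro k hk
    exact ae_all_iff.2 fun n => ae_all_iff.2 fun t =>
      hL.1 (t + 1) (Nat.le_add_left 1 t) _ (hq k hk _)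
  filter_upwards [hgood, hdense, hversion, hL.2] with ω hω hdω hvω hcω hbad
  by_contra hnB
  refine hbad ?_
  have hgoodω := hω hnB
  intro θ hθ
  obtain ⟨k, hk, ξ, hξ, hπ, hθeq⟩ := exists_eq_of_gridAccel hne hθ
  have havg : ∀ θ, avgRisk μ F ℓ p L T θ ω = 1 / (T : ℝ) * ∑ t ∈ Finset.range T,
      ((μ[fun ω => ℓ (t + 1) ω (p t ω) | F t]) ω - L (t + 1) θ ω) := by
    intro θ
    unfold avgRisk
    rw [sum_Icc_one_eq_sum_range, sum_Icc_one_eq_sum_range, ← mul_sub, ← Finset.sum_sub_distrib]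
    rfl
  have hclosed : IsClosed {z : (Set.Icc (0 : ℝ) 1 × l1Ball d) | avgRisk μ F ℓ p L T (q k z) ω ≤
      4000 * (ρ + G * (z.1 : ℝ) * s + G * s ^ 2)} := by
    refine isClosed_le ?_ (by fun_prop)
    simp only [havg]
    refine continuous_const.mul (continuous_finsetSum _ fun t _ => continuous_const.sub ?_)
    have hqc : Continuous (q k) := by
      simp only [q]
      fun_prop
    exact (hcω (t + 1) (Nat.le_add_left 1 t)).comp_continuous hqc (hq k hk)
  have hall := (TopologicalSpace.denseRange_denseSeq (Set.Icc (0 : ℝ) 1 × l1Ball d)).induction_on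
    (p := fun z : (Set.Icc (0 : ℝ) 1 × l1Ball d) => avgRisk μ F ℓ p L T (q k z) ω ≤
      4000 * (ρ + G * (z.1 : ℝ) * s + G * s ^ 2))
    (⟨gridAccel θ grid, hπ⟩, ⟨ξ, hξ⟩) hclosed (fun n => by
      have h1 := hdω k hk n fun j hj i hi => (hgoodω j hj i hi).trans (by
        rw [mul_assoc, hs2T]; exact hb)
      rw [havg]
      unfold condRegret at h1
      simpa only [hvω k hk n] using h1)
  have hqθ : q k (⟨gridAccel θ grid, hπ⟩, ⟨ξ, hξ⟩) = θ := hθeq.symm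
  rw [hqθ] at hall
  have hlast : a * G / T = G * s ^ 2 := by rw [hs2]; ring
  rw [hlast]
  exact hall
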